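/- **Setting.** There are $n\ge 1$ agents with entitlements $e_i>0$, $\sum_i e_i=1$, to a resource of size $1$. On round $t=1,2,\dots$ agent $i$ has a load $v_{it}\in(v_{\min},v_{\max}]$, where $v_{\min}>0$; loads form a fixed sequence. Agent $i$ has the payoff function $f_i(x)=\mu(x\theta_i)$, where $\mu:[0,\infty)\to\mathbb R$ is known and differentiable with $\mu'(x)\ge\kappa$ for all $x\ge 0$ for a known $\kappa>0$, and $\theta_i$ is unknown with $\theta_i\ge\theta_{\min}$ for a known $\theta_{\min}>0$. She has a threshold $\alpha_i$ in the range of $f_i$; her unit demand is $u_i^\star=f_i^{-1}(\alpha_i)=\mu^{-1}(\alpha_i)/\theta_i$ and her true demand on round $t$ is $d^\star_{it}=v_{it}u_i^\star$. Her utility $U_i:[0,\infty)\to[0,\infty)$ is a function of the allocation per unit load; it is strictly increasing on $[0,u_i^\star]$, constant on $[u_i^\star,\infty)$, and $L_i$-Lipschitz. If she is allocated $a_{it}$ on round $t$, then, given the past, her reward $X_{it}$ has mean $f_i(a_{it}/v_{it})$ and is $\sigma_{it}$-sub-Gaussian: $\mathbb E[e^{\lambda(X_{it}-f_i(a_{it}/v_{it}))}\mid\text{past}]\le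 e^{\lambda^2\sigma_{it}^2/2}$ for all $\lambda\in\mathbb R$; here $\sigma_{it}\in(\sigma_{\min},\sigma_{\max}]$ is a fixed sequence and $\sigma_{\min}>0$. **Mechanism.** Fix $\delta\in(0,1)$. Agents report thresholds at the beginning, loads at the beginning of each round, and rewards with their sub-Gaussian constants at the end of each round; the formulas below use the reports. On round $1$ agent $i$ is allocated $e_i$. On round $t\ge 2$ the allocation is that of max-min fairness with entitlements $e_i$ and demands $v_{it}\hat u_{it}$, where $\hat u_{it}$ is the upper confidence bound from all past data: $$\hat u_{it}=\frac{\mu^{-1}(\alpha_i)}{\max\{\theta_{\min},\,\hat\theta_{it}-\beta_t/A_{it}\}},\qquad \hat\theta_{it}=\operatorname*{argmin}_{\theta\ge\theta_{\min}}\Big|\sum_{s<t}\frac{a_{is}}{v_{is}\sigma_{is}^2}\Big(\mu\Big(\frac{a_{is}\theta}{v_{is}}\Big)-X_{is}\Big)\Big|,$$ $$A_{it}^2=\sum_{s<t}\frac{a_{is}^2}{v_{is}^2\sigma_{is}^2},\qquad \beta_t=\frac5\kappa\sqrt{\log\frac{n\pi^2(t-1)^2}{6\delta}},$$ with $\mu^{-1}(\alpha)=0$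 for a reported threshold $\alpha\le\mu(0)$. Max-min fairness with demands $d_i$ goes through the agents in ascending order of $d_i/e_i$; while the next agent $j$ satisfies $d_j<r\,e_j/e$, where $r$ is the remaining resource and $e$ the total entitlement of the remaining agents, she is given $d_j$; at the first agent that violates this, each remaining agent $k$ is given $r\,e_k/e$. **Notation.** For true demands $d$ and allocation $a$ let $\ell(d,a)=\min\{1-\sum_i a_i+\sum_i(a_i-d_i)^+,\ \sum_i(d_i-a_i)^+\}$, and let $L_T=\sum_{t\le T}\ell(d^\star_t,a_t)$ be the loss. Let $U_{iT}=\sum_{t\le T}U_i(a_{it}/v_{it})$ when agent $i$ is truthful, $U^{e}_{iT}=\sum_{t\le T}U_i(e_i/v_{it})$, and let $U^\pi_{iT}$ be her total utility when she follows a policy $\pi$, that is, when her reports (real thresholds and rewards, positive loads and sub-Gaussian constants) are arbitrary, possibly randomised functions of the past. Put $$C_1=\frac{\theta_{\min}}{2\sigma_{\max}v_{\max}},\quad C_2=\frac1{\sqrt{\log(1+C_1^2)}},\quad C_3=\Big(\frac{\sigma_{\max}v_{\max}}{\sigma_{\min}v_{\min}\min_i e_i}\Big)^2,\quad \bar\beta_T=\max\{1,\beta_T\},$$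 where $\bar\beta_T=1$ for $T\le 1$. **Theorem.** For every agent $i$ and every policy $\pi$ of hers, the following hold together with probability greater than $1-\delta$ (for the run in which all agents are truthful and the run in which $i$ follows $\pi$ and all the others are truthful, defined on one probability space in any way). 1. (Efficiency) When all agents are truthful, $L_T\le 1+C_2\,n\,\bar\beta_T\sqrt{T}\sqrt{\log(C_3T)}$ for all $T\ge0$; so the mechanism is asymptotically efficient, $L_T\in o(T)$. 2. (Fairness) When all agents are truthful, $U^{e}_{jT}\le U_{jT}$ for all agents $j$ and all $T$. 3. (Bayes–Nash incentive-compatibility) When all agents other than $i$ are truthful, for all $T$, $$U^\pi_{iT}-U_{iT}\le\frac{L_iC_2}{v_{\min}}(n-1)\,\bar\beta_T\sqrt T\sqrt{\log(C_3T)};$$ so the gain is at most $o(T)$. Moreover, if agent $i$ is truthful and the other agents report in any way, then with probability greater than $1-\delta$, $U^{e}_{iT}\le U_{iT}$ for all $T$. For fixed values of $\kappa,C_2,C_3,L_i,v_{\min}$, both bounds are $O\big(n\sqrt T\sqrt{\log(nT/\delta)\log T}\big)$, uniformly in $n\ge1$, $\delta\in(0,1)$, $T\ge2$. -/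

import Mathlib

open MeasureTheory Filter Asymptotics
open scoped NNReal ENNReal

noncomputable section

namespace FairDivision

/-! ### Max-min fairness -/

open Classical in
/-- The loop of the max-min fairness algorithm. The list holds the agents that have not been served
yet, in ascending order of `d j / e j`; `r` is the amount of the resource that is left, and `E` is
the total entitlement of the agents in the list. If the first agent `j` asks for less than her share
`r * (e j / E)`, she gets her demand and the loop goes on; otherwise all remaining agents share `r`
in proportion to their entitlements and the loop stops. -/
def mmfLoop {n : ℕ} (e d : Fin n → ℝ) : List (Fin n) → ℝ → ℝ → Fin n → ℝ
  | [], _, _ => fun _ => 0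
  | j :: l, r, E =>
    if d j < r * (e j / E) then
      Function.update (mmfLoop e d l (r - d j) (E - e j)) j (d j)
    else
      fun k => if k ∈ j :: l then r * (e k / E) else 0

open Classical in
/-- The agents in ascending order of `d i / e i`. -/
def mmfOrder {n : ℕ} (e d : Fin n → ℝ) : List (Fin n) :=
  (List.finRange n).insertionSort (fun i j => d i / e i ≤ d j / e j)

/-- Max-min fairness: the allocation for entitlements `e` and reported demands `d`. -/
def mmf {n : ℕ} (e d : Fin n → ℝ) : Fin n → ℝ :=
  mmfLoop e d (mmfOrder e d) 1 1

/-! ### Resources left on the table -/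

/-- Unallocated resources. -/
def lossUR {n : ℕ} (a : Fin n → ℝ) : ℝ := 1 - ∑ i, a i

/-- Over-allocated resources, for true demands `d`. -/
def lossOR {n : ℕ} (d a : Fin n → ℝ) : ℝ := ∑ i, max (a i - d i) 0

/-- Unmet demand, for true demands `d`. -/
def lossUD {n : ℕ} (d a : Fin n → ℝ) : ℝ := ∑ i, max (d i - a i) 0

/-- The instantaneous loss. -/
def lossLOT {n : ℕ} (d a : Fin n → ℝ) : ℝ :=
  min (lossUR a + lossOR d a) (lossUD d a)

/-! ### Upper confidence bounds in the parametric model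

In this part `a v σ X` are the allocations, loads, sub-Gaussian constants and rewards of one agent,
indexed by the round, and `D` is the set of rounds whose data is used. -/

/-- The inverse of an increasing function `μ` on `[0, ∞)`: if `μ x = α` with `x ≥ 0` then it is `x`,
and it is `0` for a reported threshold `α ≤ μ 0`. -/
def linkInv (μ : ℝ → ℝ) (α : ℝ) : ℝ := sInf {x | 0 ≤ x ∧ α ≤ μ x}

/-- The criterion that the estimate of the parameter minimises. -/
def glmCriterion (μ : ℝ → ℝ) (D : Finset ℕ) (a v σ X : ℕ → ℝ) (θ : ℝ) : ℝ :=
  |∑ s ∈ D, a s / (v s * σ s ^ 2) * (μ (a s * θ / v s) - X s)|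

/-- The estimate: the (least) minimiser of the criterion over `θ ≥ thetaMin`. -/
def glmEstimate (μ : ℝ → ℝ) (thetaMin : ℝ) (D : Finset ℕ) (a v σ X : ℕ → ℝ) : ℝ :=
  sInf {θ | thetaMin ≤ θ ∧
    ∀ θ', thetaMin ≤ θ' → glmCriterion μ D a v σ X θ ≤ glmCriterion μ D a v σ X θ'}

/-- The quantity `A` with `A ^ 2 = ∑ a ^ 2 / (v ^ 2 * σ ^ 2)`. -/
def dataNorm (D : Finset ℕ) (a v σ : ℕ → ℝ) : ℝ :=
  √(∑ s ∈ D, a s ^ 2 / (v s ^ 2 * σ s ^ 2))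

/-- The width `β` for `n` agents, failure probability `δ` and `m` data points. -/
def betaWidth (κ : ℝ) (n : ℕ) (δ : ℝ) (m : ℕ) : ℝ :=
  5 / κ * √(Real.log (n * Real.pi ^ 2 * (m : ℝ) ^ 2 / (6 * δ)))

/-- The lower confidence bound for the parameter. -/
def thetaLower (μ : ℝ → ℝ) (thetaMin κ : ℝ) (n : ℕ) (δ : ℝ) (D : Finset ℕ)
    (a v σ X : ℕ → ℝ) : ℝ :=
  max thetaMin (glmEstimate μ thetaMin D a v σ X - betaWidth κ n δ D.card / dataNorm D a v σ)

/-- The upper confidence bound for the unit demand at threshold `α`. -/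
def unitDemandUpper (μ : ℝ → ℝ) (thetaMin κ : ℝ) (n : ℕ) (δ : ℝ) (D : Finset ℕ)
    (α : ℝ) (a v σ X : ℕ → ℝ) : ℝ :=
  linkInv μ α / thetaLower μ thetaMin κ n δ D a v σ X

/-! ### The environment -/

/-- The data of the problem with `n` agents. Rounds are `1, 2, 3, …`; values at round `0` of
`load` and `sgc` play no role. -/
structure Model (n : ℕ) where
  /-- entitlements -/
  entitl : Fin n → ℝ
  /-- the known function `μ` on `[0, ∞)`; agent `i` has the payoff `a ↦ μ (a * theta i)` -/
  link : ℝ → ℝ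
  /-- known lower bound for the parameters -/
  thetaMin : ℝ
  /-- known lower bound for the derivative of `μ` -/
  kappa : ℝ
  /-- unknown parameters of the agents -/
  theta : Fin n → ℝ
  /-- threshold payoffs of the agents -/
  thresh : Fin n → ℝ
  /-- utilities, as functions of the allocation per unit load -/
  util : Fin n → ℝ → ℝ
  /-- Lipschitz constants of the utilities -/
  lip : Fin n → ℝ≥0
  /-- loads -/
  load : ℕ → Fin n → ℝ
  /-- sub-Gaussian constants of the rewards -/
  sgc : ℕ → Fin n → ℝ
  loadMin : ℝ
  loadMax : ℝ
  sgcMin : ℝ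
  sgcMax : ℝ

namespace Model

variable {n : ℕ} (M : Model n)

/-- The payoff of agent `i` for the allocation `x` per unit load. -/
def payoff (i : Fin n) (x : ℝ) : ℝ := M.link (x * M.theta i)

/-- The true unit demand of agent `i`: the point at which her payoff equals her threshold. -/
def unitDemand (i : Fin n) : ℝ := linkInv M.link (M.thresh i) / M.theta i

/-- The true demand of agent `i` on round `t`. -/
def demand (t : ℕ) (i : Fin n) : ℝ := M.load t i * M.unitDemand i

/-- The assumptions on the data of the problem. -/
structure Valid : Prop where
  entitl_pos : ∀ i, 0 < M.entitl i
  entitl_sum : ∑ i, M.entitl i = 1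
  link_diff : DifferentiableOn ℝ M.link (Set.Ici 0)
  kappa_pos : 0 < M.kappa
  kappa_le : ∀ x, 0 ≤ x → M.kappa ≤ derivWithin M.link (Set.Ici 0) x
  thetaMin_pos : 0 < M.thetaMin
  thetaMin_le : ∀ i, M.thetaMin ≤ M.theta i
  /-- the threshold is a payoff that agent `i` can reach -/
  thresh_mem : ∀ i, ∃ x, 0 ≤ x ∧ M.payoff i x = M.thresh i
  util_nonneg : ∀ i x, 0 ≤ x → 0 ≤ M.util i x
  util_strictMono : ∀ i, StrictMonoOn (M.util i) (Set.Icc 0 (M.unitDemand i))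
  util_const : ∀ i x, M.unitDemand i ≤ x → M.util i x = M.util i (M.unitDemand i)
  util_lip : ∀ i, LipschitzOnWith (M.lip i) (M.util i) (Set.Ici 0)
  loadMin_pos : 0 < M.loadMin
  load_mem : ∀ t i, 1 ≤ t → M.load t i ∈ Set.Ioc M.loadMin M.loadMax
  sgcMin_pos : 0 < M.sgcMin
  sgc_mem : ∀ t i, 1 ≤ t → M.sgc t i ∈ Set.Ioc M.sgcMin M.sgcMax

/-- The total utility of agent `i` over `T` rounds if she has her entitlement to herself. -/
def entitlUtility (i : Fin n) (T : ℕ) : ℝ :=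
  ∑ t ∈ Finset.Icc 1 T, M.util i (M.entitl i / M.load t i)

def C₁ : ℝ := M.thetaMin / (2 * M.sgcMax * M.loadMax)

def C₂ : ℝ := 1 / √(Real.log (1 + M.C₁ ^ 2))

def C₃ : ℝ := (M.sgcMax * M.loadMax / (M.sgcMin * M.loadMin * ⨅ i, M.entitl i)) ^ 2

end Model

/-! ### Runs of the mechanism -/

/-- A run, on the probability space `(Ω, P)`, of the learning mechanism in which every agent in `H`
is truthful, while the reports of the other agents are arbitrary adapted processes. `ℱ t` is the
information that is present after round `t`; it holds all the rewards and reports so far, and may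
hold private randomness of the agents. An agent reports her threshold at the beginning, her load at
the beginning of each round, and her reward and its sub-Gaussian constant at the end of the
round. -/
structure Run {n : ℕ} (M : Model n) (δ : ℝ) (H : Set (Fin n))
    {Ω : Type*} [mΩ : MeasurableSpace Ω] (P : Measure Ω) where
  ℱ : Filtration ℕ mΩ
  /-- reported thresholds, loads, rewards and sub-Gaussian constants -/
  repThresh : Fin n → Ω → ℝ
  repLoad : ℕ → Fin n → Ω → ℝ
  repReward : ℕ → Fin n → Ω → ℝ
  repSgc : ℕ → Fin n → Ω → ℝ
  /-- allocations and true rewards -/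
  alloc : ℕ → Fin n → Ω → ℝ
  reward : ℕ → Fin n → Ω → ℝ
  /-- reports are positive where this is meaningful, and depend only on what has happened -/
  repLoad_pos : ∀ t i ω, 0 < repLoad (t + 1) i ω
  repSgc_pos : ∀ t i ω, 0 < repSgc (t + 1) i ω
  repThresh_meas : ∀ i, Measurable[ℱ 0] (repThresh i)
  repLoad_meas : ∀ t i, Measurable[ℱ t] (repLoad (t + 1) i)
  repReward_meas : ∀ t i, Measurable[ℱ (t + 1)] (repReward (t + 1) i)
  repSgc_meas : ∀ t i, Measurable[ℱ (t + 1)] (repSgc (t + 1) i)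
  /-- the agents in `H` report truthfully -/
  truthful_thresh : ∀ i ∈ H, ∀ ω, repThresh i ω = M.thresh i
  truthful_load : ∀ i ∈ H, ∀ t ω, repLoad (t + 1) i ω = M.load (t + 1) i
  truthful_reward : ∀ i ∈ H, ∀ t ω, repReward (t + 1) i ω = reward (t + 1) i ω
  truthful_sgc : ∀ i ∈ H, ∀ t ω, repSgc (t + 1) i ω = M.sgc (t + 1) i
  /-- on round `1` every agent gets her entitlement -/
  alloc_one : ∀ i ω, alloc 1 i ω = M.entitl i
  /-- on every later round the mechanism uses max-min fairness; the demand of each agent is set to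
  her reported load times the upper confidence bound from all her past reports -/
  alloc_step : ∀ t, 2 ≤ t → ∀ i ω, alloc t i ω =
    mmf M.entitl
      (fun j => repLoad t j ω *
        unitDemandUpper M.link M.thetaMin M.kappa n δ (Finset.Ico 1 t) (repThresh j ω)
          (fun s => alloc s j ω) (fun s => repLoad s j ω)
          (fun s => repSgc s j ω) (fun s => repReward s j ω)) i
  /-- given the past, the reward of agent `i` on a round has as mean the payoff of her allocation
  per unit load, and is sub-Gaussian with the constant of that round -/
  reward_meas : ∀ t i, Measurable[ℱ (t + 1)] (reward (t + 1) i)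
  reward_integrable : ∀ t i, Integrable (reward (t + 1) i) P
  reward_mean : ∀ t i, P[reward (t + 1) i | ℱ t] =ᵐ[P]
    fun ω => M.payoff i (alloc (t + 1) i ω / M.load (t + 1) i)
  reward_exp_integrable : ∀ t i (l : ℝ), Integrable (fun ω => Real.exp
    (l * (reward (t + 1) i ω - M.payoff i (alloc (t + 1) i ω / M.load (t + 1) i)))) P
  reward_subgaussian : ∀ t i (l : ℝ), P[fun ω => Real.exp
    (l * (reward (t + 1) i ω - M.payoff i (alloc (t + 1) i ω / M.load (t + 1) i))) | ℱ t] ≤ᵐ[P]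
      fun _ => Real.exp (l ^ 2 * M.sgc (t + 1) i ^ 2 / 2)

namespace Run

variable {n : ℕ} {M : Model n} {δ : ℝ} {H : Set (Fin n)} {Ω : Type*} [MeasurableSpace Ω]
  {P : Measure Ω} (R : Run M δ H P)

/-- The loss over `T` rounds: the sum of the resources left on the table. -/
def loss (T : ℕ) (ω : Ω) : ℝ :=
  ∑ t ∈ Finset.Icc 1 T, lossLOT (M.demand t) (fun i => R.alloc t i ω)

/-- The total utility of agent `i` over `T` rounds. -/
def utility (i : Fin n) (T : ℕ) (ω : Ω) : ℝ :=
  ∑ t ∈ Finset.Icc 1 T, M.util i (R.alloc t i ω / M.load t i)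

end Run

/-! ### The bounds -/

/-- The bound on the loss over `T` rounds. -/
def lossBound (κ c₂ c₃ : ℝ) (n : ℕ) (δ : ℝ) (T : ℕ) : ℝ :=
  1 + c₂ * n * max 1 (betaWidth κ n δ (T - 1)) * √T * √(Real.log (c₃ * T))

/-- The bound on the gain of an agent who deviates for `T` rounds; `lip` is the Lipschitz constant
of her utility. -/
def gainBound (lip loadMin κ c₂ c₃ : ℝ) (n : ℕ) (δ : ℝ) (T : ℕ) : ℝ :=
  lip * c₂ / loadMin * ((n : ℝ) - 1) * max 1 (betaWidth κ n δ (T - 1)) * √T * √(Real.log (c₃ * T))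

/-- The rate `n * T ^ (1/2) * (log (n * T / δ) * log T) ^ (1/2)`. -/
def rate (n : ℕ) (δ : ℝ) (T : ℕ) : ℝ :=
  n * √T * √(Real.log (n * T / δ) * Real.log T)

end FairDivision

end

noncomputable section

namespace FairDivision

/-! ### Max-min fairness as water filling -/

/-! The proof rests on one event, `IsConfident` for every agent: at all times the weighted noise in
her rewards stays within the confidence width. On it the demand used for a truthful agent is never
below her true demand, and the rest is deterministic.

Max-min fairness is water filling, `a i = min (d i) (c * e i)` with level `c ≥ 1`, and it either
exhausts the resource or meets all the demands it was given. With over-estimated demands, the loss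
of a round is therefore at most the total over-allocation (`lossLOT_le`). The level being at least
`1` gives fairness (`min_entitl_le`). For incentives, both runs are compared with the water filling
`b` for the true demands. A deviating agent gets, up to her demand, at most `b i`, because the
others ask for more than they need (`min_le_of_le`); a truthful one falls short of `b i` by at most
the over-allocation to the others (`sub_min_le`).

Both bounds thus reduce to the total over-allocation to one truthful agent. With weights `x k = a /
(v * σ)` and `S m = ∑ k < m, x k ^ 2`, a round costs at most `max 1 β * min 1 (x m / √(S m) / C₁)`.
This is at most `max 1 β * C₂ * √(log (1 + x m ^ 2 / S m))`; the logarithms telescope, and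
Cauchy–Schwarz gives the rate `√T * √(log (C₃ * T))`.

The event is likely by a self-normalised inequality for `∑ x k * ε k`. An exponential
supermartingale is run from every starting round `s`, at the scale `√(S (s + 1))`, which is known
when round `s` is played; a deterministic induction combines these bounds
(`sum_mul_le_of_forall_scale`). One run fails with probability at most `0.46 * δ`, so two runs fail
with probability less than `δ`, however they are coupled. -/

/-- `a` is the water filling for demands `d` at level `c`. -/
structure IsWaterFilling {n : ℕ} (e d a : Fin n → ℝ) (c : ℝ) : Prop where
  eq_min : ∀ i, a i = min (d i) (c * e i)
  one_le : 1 ≤ c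
  sum_le : ∑ i, a i ≤ 1
  sum_eq_or : ∑ i, a i = 1 ∨ ∀ i, a i = d i

/-- The ratio `r / E` is the current water level. Serving an agent who asks for less than her share
can only raise it, so every agent served earlier lies below the final level `c`. The bound `c₀`
carries this monotonicity through the recursion. -/
theorem mmfLoop_eq_min {n : ℕ} {e d : Fin n → ℝ} (he : ∀ i, 0 < e i)
    (l : List (Fin n)) :
    l.Nodup → l.Pairwise (fun i j => d i / e i ≤ d j / e j) →
    ∀ r E c₀ : ℝ, 0 ≤ r → E = (l.map e).sum → c₀ * E ≤ r →
    ∃ c, c₀ ≤ c ∧ (∀ i ∈ l, mmfLoop e d l r E i = min (d i) (c * e i)) ∧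
      (l.map (mmfLoop e d l r E)).sum ≤ r ∧
      ((l.map (mmfLoop e d l r E)).sum = r ∨ ∀ i ∈ l, mmfLoop e d l r E i = d i) := by
  induction l with
  | nil =>
    intro _ _ r E c₀ hr _ _
    exact ⟨c₀, le_rfl, by simp, by simpa using hr, Or.inr (by simp)⟩
  | cons j l ih =>
    intro hnd hs r E c₀ hr hE hc
    rw [List.nodup_cons] at hnd
    rw [List.pairwise_cons] at hs
    have hsum : 0 ≤ (l.map e).sum := List.sum_nonneg (by
      intro x hx; obtain ⟨i, -, rfl⟩ := List.mem_map.1 hx; exact (he i).le)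
    rw [List.map_cons, List.sum_cons] at hE
    have hEpos : 0 < E := by have := he j; linarith
    have hcr : c₀ ≤ r / E := (le_div_iff₀ hEpos).2 hc
    have hrE : r / E * E = r := div_mul_cancel₀ _ hEpos.ne'
    have hshare : r * (e j / E) = r / E * e j := by ring
    by_cases h : d j < r * (e j / E)
    · have hdr : d j ≤ r := by
        have : r / E * e j ≤ r / E * E :=
          mul_le_mul_of_nonneg_left (by linarith) (div_nonneg hr hEpos.le)
        linarith
      -- The new lower bound is the current level: `d j < r / E * e j` gives `r / E * (E - e j) ≤ r
      -- - d j`.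
      obtain ⟨c, hcc, h1, h2, h3⟩ := ih hnd.2 hs.2 (r - d j) (E - e j) (r / E)
        (by linarith) (by linarith) (by nlinarith)
      have hj : mmfLoop e d (j :: l) r E j = d j := by simp [mmfLoop, h]
      have hi : ∀ i ∈ l, mmfLoop e d (j :: l) r E i
          = mmfLoop e d l (r - d j) (E - e j) i := by
        intro i hi
        have : i ≠ j := fun hij => hnd.1 (hij ▸ hi)
        simp [mmfLoop, h, this]
      have hmap : (l.map (mmfLoop e d (j :: l) r E)).sum
          = (l.map (mmfLoop e d l (r - d j) (E - e j))).sum := by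
        rw [List.map_congr_left hi]
      refine ⟨c, hcr.trans hcc, ?_, ?_, ?_⟩
      · intro i hmem
        rcases List.mem_cons.1 hmem with rfl | hmem
        · rw [hj, min_eq_left]
          have := mul_le_mul_of_nonneg_right hcc (he i).le
          linarith
        · rw [hi i hmem, h1 i hmem]
      · rw [List.map_cons, List.sum_cons, hj, hmap]; linarith
      · rw [List.map_cons, List.sum_cons, hj, hmap]
        refine h3.imp (fun h3 => by linarith) (fun h3 i hmem => ?_)
        rcases List.mem_cons.1 hmem with rfl | hmem
        · exact hj
        · rw [hi i hmem, h3 i hmem]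
    · have hi : ∀ i ∈ j :: l, mmfLoop e d (j :: l) r E i = r / E * e i := by
        intro i hi
        simp only [mmfLoop, h, if_false, if_pos hi]
        ring
      have hmap : ((j :: l).map (mmfLoop e d (j :: l) r E)).sum = r := by
        rw [List.map_congr_left hi, List.sum_map_mul_left, List.map_cons, List.sum_cons, ← hE,
          hrE]
      refine ⟨r / E, hcr, ?_, hmap.le, Or.inl hmap⟩
      intro i hmem
      rw [hi i hmem, min_eq_right]
      -- The order matters here: later agents ask for at least as much per entitlement as `j`, who
      -- already reaches the level `r / E`.
      have hji : d j / e j ≤ d i / e i := by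
        rcases List.mem_cons.1 hmem with rfl | hmem
        · exact le_rfl
        · exact hs.1 i hmem
      rw [not_lt, hshare, ← le_div_iff₀ (he j)] at h
      exact (le_div_iff₀ (he i)).1 (h.trans hji)

theorem exists_isWaterFilling_mmf {n : ℕ} {e d : Fin n → ℝ} (he : ∀ i, 0 < e i)
    (hsum : ∑ i, e i = 1) : ∃ c, IsWaterFilling e d (mmf e d) c := by
  classical
  have hperm : (mmfOrder e d).Perm (List.finRange n) := List.perm_insertionSort _ _
  have hs : ∀ f : Fin n → ℝ, ((mmfOrder e d).map f).sum = ∑ i, f i := fun f => by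
    rw [(hperm.map f).sum_eq, List.sum_ofFn.symm.trans (by rw [List.ofFn_eq_map])]
  have hmem : ∀ i, i ∈ mmfOrder e d := fun i => hperm.mem_iff.2 (List.mem_finRange i)
  have : Std.Total (fun i j : Fin n => d i / e i ≤ d j / e j) := ⟨fun i j => le_total _ _⟩
  have : IsTrans (Fin n) (fun i j : Fin n => d i / e i ≤ d j / e j) :=
    ⟨fun i j k => le_trans⟩
  have hpw : (mmfOrder e d).Pairwise (fun i j => d i / e i ≤ d j / e j) :=
    List.pairwise_insertionSort _ _
  obtain ⟨c, h0, h1, h2, h3⟩ := mmfLoop_eq_min he (mmfOrder e d)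
    (hperm.nodup_iff.2 (List.nodup_finRange n)) hpw 1 1 1 zero_le_one
    (by rw [hs, hsum]) (by norm_num)
  rw [hs] at h2 h3
  exact ⟨c, fun i => h1 i (hmem i), h0, h2, h3.imp id (fun h i => h i (hmem i))⟩

namespace IsWaterFilling

variable {n : ℕ} {e d D a b : Fin n → ℝ} {c c' : ℝ}

theorem le_demand (h : IsWaterFilling e d a c) (i : Fin n) : a i ≤ d i := by
  rw [h.eq_min]; exact min_le_left _ _

theorem nonneg (h : IsWaterFilling e d a c) (he : ∀ i, 0 < e i) (hd : ∀ i, 0 ≤ d i)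
    (i : Fin n) : 0 ≤ a i := by
  rw [h.eq_min]
  exact le_min (hd i) (mul_nonneg (zero_le_one.trans h.one_le) (he i).le)

theorem min_entitl_le (h : IsWaterFilling e d a c) (he : ∀ i, 0 < e i) (i : Fin n) :
    min (d i) (e i) ≤ a i := by
  rw [h.eq_min]
  exact min_le_min_left _ (le_mul_of_one_le_left (he i).le h.one_le)

/-- If the demands `D` of the algorithm dominate the true demands `d`, then the loss is at most the
over-allocation. -/
theorem lossLOT_le (h : IsWaterFilling e D a c) (hdD : ∀ i, d i ≤ D i) :
    lossLOT d a ≤ ∑ i, max (a i - d i) 0 := by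
  rcases h.sum_eq_or with h1 | h1
  · refine (min_le_left _ _).trans ?_
    simp [lossUR, lossOR, h1]
  · refine (min_le_right _ _).trans ?_
    have : lossUD d a = 0 := Finset.sum_eq_zero fun i _ => by
      rw [h1 i]; exact max_eq_right (by linarith [hdD i])
    rw [this]
    exact Finset.sum_nonneg fun i _ => le_max_right _ _

/-- An agent gets at most what she gets by asking for her true demand, up to her true demand. -/
theorem min_le_of_le (h : IsWaterFilling e d a c) (h' : IsWaterFilling e D b c')
    (he : ∀ i, 0 < e i) (i : Fin n) (hdD : ∀ j, j ≠ i → d j ≤ D j) : min (b i) (d i) ≤ a i := by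
  by_contra! hlt
  have h1 : a i < d i := hlt.trans_le (min_le_right _ _)
  have h2 : a i < b i := hlt.trans_le (min_le_left _ _)
  -- Since `a i` is below the demand of `i`, it is capped by the level `c`. Hence `c < c'` and the
  -- resource is exhausted under `a`; everyone gets at least as much under `b`, and `i` gets more,
  -- which overspends.
  have hai : a i = c * e i := by
    rw [h.eq_min] at h1 ⊢
    exact min_eq_right (by by_contra! h3; rw [min_eq_left h3.le] at h1; exact lt_irrefl _ h1)
  have hcc : c < c' := by
    have : c * e i < c' * e i := by
      rw [← hai]; exact h2.trans_le (by rw [h'.eq_min]; exact min_le_right _ _)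
    exact lt_of_mul_lt_mul_right this (he i).le
  have hsum : ∑ j, a j = 1 := h.sum_eq_or.resolve_right fun h3 => h1.ne (h3 i)
  have : ∑ j, a j < ∑ j, b j := Finset.sum_lt_sum (fun j _ => by
    by_cases hj : j = i
    · rw [hj]; exact h2.le
    · rw [h.eq_min, h'.eq_min]
      exact min_le_min (hdD j hj) (mul_le_mul_of_nonneg_right hcc.le (he j).le))
    ⟨i, Finset.mem_univ i, h2⟩
  linarith [h'.sum_le]

/-- If the demands `D` of the algorithm dominate the true demands `d`, then what an agent misses
is at most the over-allocation to the others. -/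
theorem sub_min_le (h : IsWaterFilling e d a c) (h' : IsWaterFilling e D b c')
    (he : ∀ i, 0 < e i) (i : Fin n) (hdD : d i ≤ D i) :
    a i - min (b i) (d i) ≤ ∑ j ∈ Finset.univ.erase i, max (b j - d j) 0 := by
  have hnn : 0 ≤ ∑ j ∈ Finset.univ.erase i, max (b j - d j) 0 :=
    Finset.sum_nonneg fun j _ => le_max_right _ _
  rcases le_or_gt (a i) (b i) with h1 | h1
  · linarith [le_min h1 (h.le_demand i)]
  have hbi : b i < D i := h1.trans_le ((h.le_demand i).trans hdD)
  have hb : b i = c' * e i := by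
    rw [h'.eq_min] at hbi ⊢
    exact min_eq_right (by by_contra! h3; rw [min_eq_left h3.le] at hbi; exact lt_irrefl _ hbi)
  have hcc : c' < c := by
    have : c' * e i < c * e i := by
      rw [← hb]; exact h1.trans_le (by rw [h.eq_min]; exact min_le_right _ _)
    exact lt_of_mul_lt_mul_right this (he i).le
  have hsum : ∑ j, b j = 1 := h'.sum_eq_or.resolve_right fun h3 => hbi.ne (h3 i)
  rw [min_eq_left (h1.le.trans (h.le_demand i))]
  -- Under `a` an agent gets either her true demand or `c * e j`; in the latter case the lower level
  -- `c'` cannot give her more. As `b` spends everything, what `i` lacks is contained in this sum.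
  have hle : ∑ j ∈ Finset.univ.erase i, (b j - a j)
      ≤ ∑ j ∈ Finset.univ.erase i, max (b j - d j) 0 := by
    refine Finset.sum_le_sum fun j _ => ?_
    rcases le_total (d j) (c * e j) with h3 | h3
    · rw [h.eq_min j, min_eq_left h3]; exact le_max_left _ _
    · refine le_trans ?_ (le_max_right _ _)
      rw [h.eq_min j, min_eq_right h3, h'.eq_min j]
      have := mul_le_mul_of_nonneg_right hcc.le (he j).le
      linarith [min_le_right (D j) (c' * e j)]
  rw [Finset.sum_sub_distrib] at hle
  have e1 := Finset.add_sum_erase Finset.univ b (Finset.mem_univ i)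
  have e2 := Finset.add_sum_erase Finset.univ a (Finset.mem_univ i)
  linarith [h.sum_le]

end IsWaterFilling

/-! ### The estimate of the parameter -/

section Link

variable {μ : ℝ → ℝ} {κ : ℝ}

theorem mul_sub_le_link_sub (hμ : DifferentiableOn ℝ μ (Set.Ici 0))
    (hκ : ∀ x, 0 ≤ x → κ ≤ derivWithin μ (Set.Ici 0) x) {x y : ℝ} (hx : 0 ≤ x) (hxy : x ≤ y) :
    κ * (y - x) ≤ μ y - μ x := by
  refine (convex_Ici 0).mul_sub_le_image_sub_of_le_deriv hμ.continuousOn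
    (hμ.mono interior_subset) (fun z hz => ?_) x hx y (hx.trans hxy) hxy
  rw [interior_Ici] at hz
  rw [← derivWithin_of_mem_nhds (Ici_mem_nhds hz)]
  exact hκ z (le_of_lt hz)

theorem linkInv_nonneg (μ : ℝ → ℝ) (α : ℝ) : 0 ≤ linkInv μ α :=
  Real.sInf_nonneg fun _ hx => hx.1

variable (hκ : 0 < κ) (h : ∀ x y, 0 ≤ x → x ≤ y → κ * (y - x) ≤ μ y - μ x)
include hκ h

theorem linkInv_link {x : ℝ} (hx : 0 ≤ x) : linkInv μ (μ x) = x := by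
  refine le_antisymm (csInf_le ⟨0, fun _ hy => hy.1⟩ ⟨hx, le_rfl⟩)
    (le_csInf ⟨x, hx, le_rfl⟩ fun y hy => ?_)
  by_contra! hlt
  have := h y x hy.1 hlt.le
  have := mul_pos hκ (sub_pos.2 hlt)
  linarith [hy.2]

/-- Monotonicity makes `linkInv μ` Borel measurable, which is how the weights are shown to be
predictable. Linear growth of `μ` keeps the set under the infimum nonempty, so no default value of
`sInf` intervenes. -/
theorem monotone_linkInv : Monotone (linkInv μ) := by
  intro α β hαβ
  refine csInf_le_csInf ⟨0, fun _ hy => hy.1⟩ ?_ fun x hx => ⟨hx.1, hαβ.trans hx.2⟩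
  refine ⟨max 0 ((β - μ 0) / κ), le_max_left _ _, ?_⟩
  have h1 := h 0 _ le_rfl (le_max_left 0 ((β - μ 0) / κ))
  have h2 := mul_le_mul_of_nonneg_left (le_max_right 0 ((β - μ 0) / κ)) hκ.le
  rw [mul_div_cancel₀ _ hκ.ne'] at h2
  linarith

end Link

/-- A minimiser of `|g|` over `[p, ∞)` is close to every point of `[p, ∞)` at which `g` is small,
if `g` grows at least linearly. -/
theorem abs_sInf_argmin_sub_le {g : ℝ → ℝ} {p q c : ℝ} (hc : 0 < c)
    (hg : ContinuousOn g (Set.Ici p))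
    (hgrow : ∀ x y, p ≤ x → x ≤ y → c * (y - x) ≤ g y - g x) (hq : p ≤ q) :
    c * |sInf {x | p ≤ x ∧ ∀ y, p ≤ y → |g x| ≤ |g y|} - q| ≤ |g q| := by
  set S := {x | p ≤ x ∧ ∀ y, p ≤ y → |g x| ≤ |g y|}
  have hpair : ∀ x y, p ≤ x → p ≤ y → c * |x - y| ≤ |g x - g y| := by
    intro x y hx hy
    rcases le_total x y with hxy | hxy
    · rw [abs_sub_comm, abs_sub_comm (g x), abs_of_nonneg (sub_nonneg.2 hxy)]
      exact (hgrow x y hx hxy).trans (le_abs_self _)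
    · rw [abs_of_nonneg (sub_nonneg.2 hxy)]
      exact (hgrow y x hy hxy).trans (le_abs_self _)
  -- The minimiser is unique, so `sInf` picks it. It is `p` if `0 ≤ g p`, and otherwise the zero of
  -- `g`.
  have key : ∃ x ∈ S, c * |x - q| ≤ |g q| ∧ ∀ y ∈ S, y = x := by
    rcases le_or_gt 0 (g p) with h0 | h0
    · have hp : ∀ y, p ≤ y → g p ≤ g y := fun y hy => by
        have := hgrow p y le_rfl hy
        have := mul_nonneg hc.le (sub_nonneg.2 hy)
        linarith
      refine ⟨p, ⟨le_rfl, fun y hy => ?_⟩, ?_, fun y hy => ?_⟩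
      · rw [abs_of_nonneg h0]; exact (hp y hy).trans (le_abs_self _)
      · refine (hpair p q le_rfl hq).trans ?_
        rw [abs_sub_comm, abs_of_nonneg (sub_nonneg.2 (hp q hq)),
          abs_of_nonneg (h0.trans (hp q hq))]
        linarith
      · have h1 := hy.2 p le_rfl
        rw [abs_of_nonneg h0, abs_of_nonneg (h0.trans (hp y hy.1))] at h1
        have h2 := hgrow p y le_rfl hy.1
        have h3 : c * (y - p) ≤ c * 0 := by linarith
        linarith [le_of_mul_le_mul_left h3 hc, hy.1]
    · obtain ⟨x, hx, hx0⟩ : ∃ x, p ≤ x ∧ g x = 0 := by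
        -- At this point linear growth has made up for the negative value `g p`, so the intermediate
        -- value theorem applies.
        have hpz : p ≤ p - g p / c := by
          have := div_neg_of_neg_of_pos h0 hc; linarith
        have h1 := hgrow p (p - g p / c) le_rfl hpz
        rw [show c * (p - g p / c - p) = - g p by field_simp; ring] at h1
        obtain ⟨x, hx, hx0⟩ := intermediate_value_Icc hpz
          (hg.mono Set.Icc_subset_Ici_self) (⟨h0.le, by linarith⟩ : (0 : ℝ) ∈ Set.Icc (g p) _)
        exact ⟨x, hx.1, hx0⟩
      refine ⟨x, ⟨hx, fun y _ => by rw [hx0, abs_zero]; exact abs_nonneg _⟩, ?_, fun y hy => ?_⟩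
      · have := hpair x q hx hq
        rwa [hx0, zero_sub, abs_neg] at this
      · have h1 := hy.2 x hx
        rw [hx0, abs_zero] at h1
        have h2 := hpair y x hy.1 hx
        rw [hx0, sub_zero] at h2
        have h3 : c * |y - x| ≤ c * 0 := by linarith
        have := le_of_mul_le_mul_left h3 hc
        exact sub_eq_zero.1 (abs_eq_zero.1 (le_antisymm this (abs_nonneg _)))
  obtain ⟨x, hxS, hx, huniq⟩ := key
  have : S = {x} := Set.eq_singleton_iff_unique_mem.2 ⟨hxS, huniq⟩
  rwa [this, csInf_singleton]

/-- The error of the estimate is controlled by the noise. -/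
theorem abs_glmEstimate_sub_le {μ : ℝ → ℝ} {κ p θ : ℝ} (hκ : 0 < κ)
    (hμ : ContinuousOn μ (Set.Ici 0))
    (h : ∀ x y, 0 ≤ x → x ≤ y → κ * (y - x) ≤ μ y - μ x) (hp : 0 ≤ p) (hθ : p ≤ θ)
    {D : Finset ℕ} {a v σ X : ℕ → ℝ} (ha : ∀ s ∈ D, 0 ≤ a s) (hv : ∀ s ∈ D, 0 < v s)
    (hA : 0 < dataNorm D a v σ) :
    κ * dataNorm D a v σ ^ 2 * |glmEstimate μ p D a v σ X - θ|
      ≤ |∑ s ∈ D, a s / (v s * σ s ^ 2) * (X s - μ (a s / v s * θ))| := by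
  have hsq : dataNorm D a v σ ^ 2 = ∑ s ∈ D, a s ^ 2 / (v s ^ 2 * σ s ^ 2) :=
    Real.sq_sqrt (Finset.sum_nonneg fun s _ => by positivity)
  have hw : ∀ s ∈ D, 0 ≤ a s / (v s * σ s ^ 2) := fun s hs =>
    div_nonneg (ha s hs) (mul_nonneg (hv s hs).le (sq_nonneg _))
  have key := abs_sInf_argmin_sub_le (p := p) (q := θ)
    (g := fun x => ∑ s ∈ D, a s / (v s * σ s ^ 2) * (μ (a s * x / v s) - X s))
    (c := κ * dataNorm D a v σ ^ 2) (by positivity) ?_ ?_ hθ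
  · refine key.trans (le_of_eq ?_)
    rw [← abs_neg, ← Finset.sum_neg_distrib]
    congr 1
    refine Finset.sum_congr rfl fun s _ => ?_
    rw [show a s * θ / v s = a s / v s * θ by ring]; ring
  · refine continuousOn_finsetSum _ fun s hs => continuousOn_const.mul
      (ContinuousOn.sub (hμ.comp (by fun_prop) fun x hx => ?_) continuousOn_const)
    exact div_nonneg (mul_nonneg (ha s hs) (hp.trans hx)) (hv s hs).le
  · intro x y hx hxy
    rw [hsq, mul_assoc, Finset.sum_mul, Finset.mul_sum, ← Finset.sum_sub_distrib]
    refine Finset.sum_le_sum fun s hs => ?_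
    have h1 := h (a s * x / v s) (a s * y / v s)
      (div_nonneg (mul_nonneg (ha s hs) (hp.trans hx)) (hv s hs).le)
      (div_le_div_of_nonneg_right (mul_le_mul_of_nonneg_left hxy (ha s hs)) (hv s hs).le)
    have h2 := mul_le_mul_of_nonneg_left h1 (hw s hs)
    have hvs := (hv s hs).ne'
    calc _ = a s / (v s * σ s ^ 2) * (κ * (a s * y / v s - a s * x / v s)) := by
          simp only [div_eq_mul_inv, mul_inv]; ring
      _ ≤ _ := h2
      _ = _ := by ring

/-! ### A self-normalised bound -/

section SelfNormalised

variable {Ω : Type*}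

/-- Tilting by a sub-Gaussian variable with a coefficient known before does not increase
integrals: the step of an exponential supermartingale. -/
theorem lintegral_mul_exp_le {m mΩ : MeasurableSpace Ω} {P : Measure Ω} (hm : m ≤ mΩ)
    {ε : Ω → ℝ} (hε : Measurable ε)
    (hsub : ∀ (v : ℝ) (B : Set Ω), MeasurableSet[m] B →
      ∫⁻ ω in B, ENNReal.ofReal (Real.exp (v * ε ω - v ^ 2 / 2)) ∂P ≤ P B)
    {l : Ω → ℝ} (hl : Measurable[m] l) {W : Ω → ℝ≥0∞} (hW : Measurable[m] W) :
    ∫⁻ ω, W ω * ENNReal.ofReal (Real.exp (l ω * ε ω - l ω ^ 2 / 2)) ∂P ≤ ∫⁻ ω, W ω ∂P := by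
  have hmeas : ∀ v : ℝ, Measurable fun ω => ENNReal.ofReal (Real.exp (v * ε ω - v ^ 2 / 2)) :=
    fun v => by fun_prop
  -- For a constant coefficient the hypothesis says that the tilted measure is dominated by `P` on
  -- the sub-σ-algebra, so the same holds for integrals of functions measurable there.
  have hconst : ∀ (v : ℝ) (V : Ω → ℝ≥0∞), Measurable[m] V →
      ∫⁻ ω, V ω * ENNReal.ofReal (Real.exp (v * ε ω - v ^ 2 / 2)) ∂P ≤ ∫⁻ ω, V ω ∂P := by
    intro v V hV
    set f : Ω → ℝ≥0∞ := fun ω => ENNReal.ofReal (Real.exp (v * ε ω - v ^ 2 / 2)) with hf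
    have hle : (P.withDensity f).trim hm ≤ P.trim hm := by
      refine Measure.le_iff.2 fun B hB => ?_
      rw [trim_measurableSet_eq hm hB, trim_measurableSet_eq hm hB,
        withDensity_apply _ (hm B hB)]
      exact hsub v B hB
    calc ∫⁻ ω, V ω * f ω ∂P = ∫⁻ ω, V ω ∂(P.withDensity f) := by
          rw [lintegral_withDensity_eq_lintegral_mul _ (hmeas v) (hV.mono hm le_rfl)]
          simp [hf, mul_comm]
      _ = ∫⁻ ω, V ω ∂((P.withDensity f).trim hm) := (lintegral_trim hm hV).symm
      _ ≤ ∫⁻ ω, V ω ∂(P.trim hm) := lintegral_mono' hle le_rfl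
      _ = ∫⁻ ω, V ω ∂P := lintegral_trim hm hV
  have hsimple : ∀ (s : Ω → ℝ) (S : Finset ℝ), Measurable[m] s → (∀ ω, s ω ∈ S) →
      ∫⁻ ω, W ω * ENNReal.ofReal (Real.exp (s ω * ε ω - s ω ^ 2 / 2)) ∂P ≤ ∫⁻ ω, W ω ∂P := by
    intro s S hs hS
    have hset : ∀ v, MeasurableSet[m] (s ⁻¹' {v}) := fun v => hs (measurableSet_singleton v)
    have hind : ∀ v, Measurable[m] ((s ⁻¹' {v}).indicator W) := fun v =>
      hW.indicator (hset v)
    have hsplit : ∀ F : ℝ → Ω → ℝ≥0∞, ∀ ω, W ω * F (s ω) ω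
        = ∑ v ∈ S, (s ⁻¹' {v}).indicator W ω * F v ω := by
      intro F ω
      rw [Finset.sum_eq_single (s ω)]
      · simp
      · intro v _ hv
        rw [Set.indicator_of_notMem (by simpa using fun h => hv h.symm), zero_mul]
      · intro h; exact absurd (hS ω) h
    calc _ = ∫⁻ ω, ∑ v ∈ S, (s ⁻¹' {v}).indicator W ω *
            ENNReal.ofReal (Real.exp (v * ε ω - v ^ 2 / 2)) ∂P :=
          lintegral_congr fun ω =>
            hsplit (fun v ω => ENNReal.ofReal (Real.exp (v * ε ω - v ^ 2 / 2))) ω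
      _ = ∑ v ∈ S, ∫⁻ ω, (s ⁻¹' {v}).indicator W ω *
            ENNReal.ofReal (Real.exp (v * ε ω - v ^ 2 / 2)) ∂P :=
          lintegral_finsetSum _ fun v _ => ((hind v).mono hm le_rfl).mul (hmeas v)
      _ ≤ ∑ v ∈ S, ∫⁻ ω, (s ⁻¹' {v}).indicator W ω ∂P :=
          Finset.sum_le_sum fun v _ => hconst v _ (hind v)
      _ = ∫⁻ ω, ∑ v ∈ S, (s ⁻¹' {v}).indicator W ω ∂P :=
          (lintegral_finsetSum _ fun v _ => (hind v).mono hm le_rfl).symm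
      _ = ∫⁻ ω, W ω ∂P := lintegral_congr fun ω => by
          have := hsplit (fun _ _ => 1) ω
          simp only [mul_one] at this
          exact this.symm
  -- A general coefficient is a pointwise limit of simple ones, and Fatou's lemma preserves the
  -- inequality. No integrability or boundedness of `l` is needed.
  have hl' : @StronglyMeasurable Ω ℝ _ m l := hl.stronglyMeasurable
  have htend : ∀ ω, Tendsto (fun k => W ω * ENNReal.ofReal
      (Real.exp (hl'.approx k ω * ε ω - hl'.approx k ω ^ 2 / 2))) atTop
      (nhds (W ω * ENNReal.ofReal (Real.exp (l ω * ε ω - l ω ^ 2 / 2)))) := by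
    intro ω
    have h1 := hl'.tendsto_approx ω
    refine ENNReal.Tendsto.const_mul (ENNReal.tendsto_ofReal
      ((Real.continuous_exp.tendsto _).comp ((h1.mul_const _).sub ((h1.pow 2).div_const 2))))
      (Or.inl ?_)
    simp [Real.exp_pos]
  calc _ = ∫⁻ ω, liminf (fun k => W ω * ENNReal.ofReal
      (Real.exp (hl'.approx k ω * ε ω - hl'.approx k ω ^ 2 / 2))) atTop ∂P :=
        lintegral_congr fun ω => (htend ω).liminf_eq.symm
    _ ≤ liminf (fun k => ∫⁻ ω, W ω * ENNReal.ofReal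
      (Real.exp (hl'.approx k ω * ε ω - hl'.approx k ω ^ 2 / 2)) ∂P) atTop := by
        refine lintegral_liminf_le fun k => ?_
        have h1 : Measurable (hl'.approx k) :=
          (@SimpleFunc.measurable Ω ℝ m _ (hl'.approx k)).mono hm le_rfl
        have h2 := hW.mono hm le_rfl
        fun_prop
    _ ≤ ∫⁻ ω, W ω ∂P := by
        refine liminf_le_of_frequently_le' (Frequently.of_forall fun k => hsimple _ _
          (@SimpleFunc.measurable Ω ℝ m _ (hl'.approx k))
          (@SimpleFunc.mem_range_self Ω ℝ m (hl'.approx k)))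

variable {mΩ : MeasurableSpace Ω} {P : Measure Ω} {ℱ : Filtration ℕ mΩ} {ε : ℕ → Ω → ℝ}

/-- `ε k` is sub-Gaussian with constant `1` given `ℱ k`, and known at time `k + 1`. -/
structure IsSubgaussianNoise (P : Measure Ω) (ℱ : Filtration ℕ mΩ) (ε : ℕ → Ω → ℝ) : Prop where
  meas : ∀ k, Measurable[ℱ (k + 1)] (ε k)
  setLIntegral_le : ∀ k (v : ℝ) (B : Set Ω), MeasurableSet[ℱ k] B →
    ∫⁻ ω in B, ENNReal.ofReal (Real.exp (v * ε k ω - v ^ 2 / 2)) ∂P ≤ P B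

theorem IsSubgaussianNoise.neg (h : IsSubgaussianNoise P ℱ ε) :
    IsSubgaussianNoise P ℱ (fun k ω => - ε k ω) where
  meas k := (h.meas k).neg
  setLIntegral_le k v B hB := by
    simpa using h.setLIntegral_le k (-v) B hB

theorem IsSubgaussianNoise.lintegral_exp_le [IsProbabilityMeasure P]
    (h : IsSubgaussianNoise P ℱ ε) {l : ℕ → Ω → ℝ} (hl : ∀ k, Measurable[ℱ k] (l k)) (m : ℕ) :
    ∫⁻ ω, ENNReal.ofReal (Real.exp
      (∑ k ∈ Finset.range m, (l k ω * ε k ω - l k ω ^ 2 / 2))) ∂P ≤ 1 := by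
  induction m with
  | zero => simp
  | succ m ih =>
    have hW : Measurable[ℱ m] fun ω => ENNReal.ofReal (Real.exp
        (∑ k ∈ Finset.range m, (l k ω * ε k ω - l k ω ^ 2 / 2))) := by
      refine ENNReal.measurable_ofReal.comp (Real.measurable_exp.comp
        (Finset.measurable_fun_sum _ fun k hk => ?_))
      have hkm := Finset.mem_range.1 hk
      have h1 : Measurable[ℱ m] (l k) := (hl k).mono (ℱ.mono hkm.le) le_rfl
      have h2 : Measurable[ℱ m] (ε k) := (h.meas k).mono (ℱ.mono hkm) le_rfl
      exact (h1.mul h2).sub ((h1.pow_const 2).div_const 2)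
    refine le_trans (le_of_eq ?_) ((lintegral_mul_exp_le (ℱ.le m)
      ((h.meas m).mono (ℱ.le _) le_rfl) (h.setLIntegral_le m) (hl m) hW).trans ih)
    refine lintegral_congr fun ω => ?_
    rw [Finset.sum_range_succ, Real.exp_add, ENNReal.ofReal_mul (Real.exp_pos _).le]

/-- Markov's inequality for the exponential supermartingale. -/
theorem IsSubgaussianNoise.measure_lt_le [IsProbabilityMeasure P]
    (h : IsSubgaussianNoise P ℱ ε) {l : ℕ → Ω → ℝ} (hl : ∀ k, Measurable[ℱ k] (l k)) (m : ℕ)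
    (r : ℝ) :
    P {ω | r < ∑ k ∈ Finset.range m, (l k ω * ε k ω - l k ω ^ 2 / 2)}
      ≤ ENNReal.ofReal (Real.exp (-r)) := by
  have hmeas : Measurable fun ω => ENNReal.ofReal (Real.exp
        (∑ k ∈ Finset.range m, (l k ω * ε k ω - l k ω ^ 2 / 2))) := by
    refine ENNReal.measurable_ofReal.comp (Real.measurable_exp.comp
      (Finset.measurable_fun_sum _ fun k hk => ?_))
    have h1 : Measurable (l k) := (hl k).mono (ℱ.le _) le_rfl
    have h2 : Measurable (ε k) := (h.meas k).mono (ℱ.le _) le_rfl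
    fun_prop
  have h0 : ENNReal.ofReal (Real.exp r) ≠ 0 := by simp [Real.exp_pos]
  calc _ ≤ P {ω | ENNReal.ofReal (Real.exp r) ≤ ENNReal.ofReal (Real.exp
        (∑ k ∈ Finset.range m, (l k ω * ε k ω - l k ω ^ 2 / 2)))} :=
        measure_mono fun ω hω => ENNReal.ofReal_le_ofReal (Real.exp_le_exp.2 (le_of_lt hω))
    _ ≤ _ / ENNReal.ofReal (Real.exp r) :=
        meas_ge_le_lintegral_div hmeas.aemeasurable h0 ENNReal.ofReal_ne_top
    _ ≤ 1 / ENNReal.ofReal (Real.exp r) := by gcongr; exact h.lintegral_exp_le hl m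
    _ = _ := by
        rw [Real.exp_neg, ENNReal.ofReal_inv_of_pos (Real.exp_pos _), one_div]

/-- If the increments of a sum are controlled at the scale of each of its weights, then the whole
sum is controlled by the square root of the sum of squared weights. -/
theorem sum_mul_le_of_forall_scale {x ε : ℕ → ℝ} (hx : x 0 ≠ 0) {g : ℕ → ℝ} (hg : Monotone g)
    (hg0 : ∀ m, 1 ≤ m → 0 < g m)
    (hscale : ∀ m, ∀ s < m, ∑ k ∈ Finset.Ico s m,
      (3 / 2 * g m / √(∑ j ∈ Finset.range (s + 1), x j ^ 2) * x k * ε k -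
        (3 / 2 * g m / √(∑ j ∈ Finset.range (s + 1), x j ^ 2) * x k) ^ 2 / 2) ≤ 4 * g m ^ 2)
    (m : ℕ) :
    ∑ k ∈ Finset.range m, x k * ε k ≤ 5 * g m * √(∑ k ∈ Finset.range m, x k ^ 2) := by
  induction m using Nat.strong_induction_on with
  | _ m ih =>
  rcases Nat.eq_zero_or_pos m with rfl | hm
  · simp
  set A : ℕ → ℝ := fun m => √(∑ k ∈ Finset.range m, x k ^ 2) with hA
  have hsq : ∀ m, A m ^ 2 = ∑ k ∈ Finset.range m, x k ^ 2 := fun m =>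
    Real.sq_sqrt (Finset.sum_nonneg fun k _ => sq_nonneg _)
  have hAmono : Monotone A := fun i j hij => Real.sqrt_le_sqrt
    (Finset.sum_le_sum_of_subset_of_nonneg (Finset.range_mono hij) fun k _ _ => sq_nonneg _)
  have hApos : ∀ s, 0 < A (s + 1) := fun s => by
    refine lt_of_lt_of_le ?_ (hAmono (Nat.le_add_left 1 s))
    simpa [hA, Real.sqrt_sq_eq_abs] using hx
  have hAm : 0 < A m := by obtain ⟨k, rfl⟩ := Nat.exists_eq_succ_of_ne_zero hm.ne'; exact hApos k
  -- The least such `s` splits the sum. Up to `s` the norm is at most `A m / 4`, so induction gives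
  -- a quarter of the target; from `s` on, the scale `A (s + 1)` is within a factor `4` of `A m`.
  have hex : ∃ s, s < m ∧ A m ≤ 4 * A (s + 1) := ⟨m - 1, by omega, by
    rw [Nat.sub_add_cancel hm]; linarith⟩
  classical
  obtain ⟨hsm, hs4⟩ := Nat.find_spec hex
  set s := Nat.find hex
  have hsmall : A s ≤ A m / 4 := by
    rcases Nat.eq_zero_or_pos s with h0 | h0
    · rw [h0]; simp only [hA, Finset.range_zero, Finset.sum_empty, Real.sqrt_zero]; positivity
    · have := Nat.find_min hex (m := s - 1) (Nat.sub_lt h0 one_pos)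
      rw [not_and, show s - 1 + 1 = s by omega] at this
      have := this (by omega)
      linarith
  have hgm := hg0 m hm
  have h1 : ∑ k ∈ Finset.range s, x k * ε k ≤ 5 * g m * (A m / 4) := by
    rcases Nat.eq_zero_or_pos s with h0 | h0
    · rw [h0]; simp only [Finset.range_zero, Finset.sum_empty]; positivity
    · refine (ih s hsm).trans ?_
      have := hg0 s h0
      gcongr
      exact hg hsm.le
  set a := A (s + 1)
  have ha : 0 < a := hApos s
  have ham : a ≤ A m := hAmono hsm
  set Y := ∑ k ∈ Finset.Ico s m, x k * ε k with hY
  have hsumsq : ∑ k ∈ Finset.Ico s m, x k ^ 2 ≤ A m ^ 2 := by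
    rw [hsq]
    exact Finset.sum_le_sum_of_subset_of_nonneg (fun k hk => by
      simp at hk ⊢; omega) fun k _ _ => sq_nonneg _
  have h2 : 3 / 2 * g m / a * Y - (3 / 2 * g m / a) ^ 2 / 2 * A m ^ 2 ≤ 4 * g m ^ 2 := by
    refine le_trans ?_ (hscale m s hsm)
    rw [Finset.sum_sub_distrib, hY, Finset.mul_sum]
    refine sub_le_sub (le_of_eq (Finset.sum_congr rfl fun k _ => by ring)) ?_
    refine le_trans (le_of_eq ?_) (mul_le_mul_of_nonneg_left hsumsq (by positivity))
    rw [Finset.mul_sum]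
    exact Finset.sum_congr rfl fun k _ => by ring
  -- The budget is `5 = 5 / 4 + 15 / 4`. With `ρ = A m / a ∈ [1, 4]` the claim is `4 + 9 / 8 * ρ ^ 2
  -- ≤ 45 / 8 * ρ`, which follows from `(ρ - 1) * (4 - ρ) ≥ 0`.
  have h3 : Y ≤ 15 / 4 * g m * A m := by
    have h4 : 3 / 2 * g m / a * Y ≤ 3 / 2 * g m / a * (15 / 4 * g m * A m) := by
      refine (by linarith : _ ≤ 4 * g m ^ 2 + (3 / 2 * g m / a) ^ 2 / 2 * A m ^ 2).trans ?_
      rw [← sub_nonneg]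
      have : 3 / 2 * g m / a * (15 / 4 * g m * A m)
          - (4 * g m ^ 2 + (3 / 2 * g m / a) ^ 2 / 2 * A m ^ 2)
          = g m ^ 2 / a ^ 2 * (45 / 8 * A m * a - 4 * a ^ 2 - 9 / 8 * A m ^ 2) := by
        field_simp; ring
      rw [this]
      refine mul_nonneg (by positivity) ?_
      nlinarith [mul_nonneg (sub_nonneg.2 ham) (by linarith : 0 ≤ 4 * a - A m)]
    exact le_of_mul_le_mul_left h4 (by positivity)
  have h5 : ∑ k ∈ Finset.range m, x k * ε k = ∑ k ∈ Finset.range s, x k * ε k + Y :=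
    (Finset.sum_range_add_sum_Ico _ hsm.le).symm
  rw [h5]
  change _ ≤ 5 * g m * A m
  linarith

/-- The self-normalised bound, at all times, without any bound on the range of the predictable
weights. -/
theorem IsSubgaussianNoise.measure_exists_lt_le [IsProbabilityMeasure P]
    (h : IsSubgaussianNoise P ℱ ε) {x : ℕ → Ω → ℝ} (hx : ∀ k, Measurable[ℱ k] (x k))
    (hx0 : ∀ ω, x 0 ω ≠ 0) {g : ℕ → ℝ} (hg : Monotone g) (hg0 : ∀ m, 1 ≤ m → 0 < g m) :
    P {ω | ∃ m, 5 * g m * √(∑ k ∈ Finset.range m, x k ω ^ 2)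
        < ∑ k ∈ Finset.range m, x k ω * ε k ω}
      ≤ ∑' m : ℕ, m * ENNReal.ofReal (Real.exp (-(4 * g m ^ 2))) := by
  -- The coefficient is switched on at `s`, when `x 0, …, x s`, and hence its scale, are known; this
  -- makes it predictable.
  set l : ℕ → ℕ → ℕ → Ω → ℝ := fun m s k ω => if s ≤ k then
    3 / 2 * g m / √(∑ j ∈ Finset.range (s + 1), x j ω ^ 2) * x k ω else 0 with hl
  have hlm : ∀ m s k, Measurable[ℱ k] (l m s k) := by
    intro m s k
    by_cases hsk : s ≤ k
    · simp only [hl, if_pos hsk]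
      have h1 : Measurable[ℱ k] fun ω => ∑ j ∈ Finset.range (s + 1), x j ω ^ 2 :=
        Finset.measurable_fun_sum _ fun j hj => (((hx j).mono (ℱ.mono
          ((Finset.mem_range_succ_iff.1 hj).trans hsk)) le_rfl).pow_const 2)
      exact (measurable_const.div (Real.continuous_sqrt.measurable.comp h1)).mul (hx k)
    · simp only [hl, if_neg hsk]; exact measurable_const
  have hsub : {ω | ∃ m, 5 * g m * √(∑ k ∈ Finset.range m, x k ω ^ 2)
        < ∑ k ∈ Finset.range m, x k ω * ε k ω} ⊆ ⋃ m : ℕ, ⋃ s ∈ Finset.range m,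
        {ω | 4 * g m ^ 2 < ∑ k ∈ Finset.range m,
          (l m s k ω * ε k ω - l m s k ω ^ 2 / 2)} := by
    rintro ω ⟨m₀, hm₀⟩
    by_contra hcon
    simp only [Set.mem_iUnion, Set.mem_ofPred_eq, not_exists, not_lt, Finset.mem_range] at hcon
    refine absurd (sum_mul_le_of_forall_scale (hx0 ω) hg hg0 (fun m s hsm => ?_) m₀)
      (not_le.2 hm₀)
    refine le_trans (le_of_eq ?_) (hcon m s hsm)
    rw [← Finset.sum_range_add_sum_Ico _ hsm.le, Finset.sum_eq_zero (s := Finset.range s), zero_add]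
    · refine Finset.sum_congr rfl fun k hk => ?_
      simp only [hl, if_pos (Finset.mem_Ico.1 hk).1]
    · intro k hk
      simp [hl, not_le.2 (Finset.mem_range.1 hk)]
  refine (measure_mono hsub).trans ((measure_iUnion_le _).trans (ENNReal.tsum_le_tsum fun m => ?_))
  -- The factor `m` in the series counts the possible starting rounds `s < m`.
  refine (measure_biUnion_finset_le _ _).trans ((Finset.sum_le_sum fun s _ =>
    h.measure_lt_le (hlm m s) m _).trans ?_)
  simp

end SelfNormalised

/-! ### The confidence bounds hold with high probability -/

/-- The width of the confidence interval for `m` data points, up to the factor `5 / κ`. -/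
def stdWidth (n : ℕ) (δ : ℝ) (m : ℕ) : ℝ :=
  √(Real.log (n * Real.pi ^ 2 * (m : ℝ) ^ 2 / (6 * δ)))

theorem one_lt_stdWidth_arg {n : ℕ} {δ : ℝ} (hn : 1 ≤ n) (hδ₀ : 0 < δ) (hδ₁ : δ < 1) {m : ℕ}
    (hm : 1 ≤ m) : 1 < n * Real.pi ^ 2 * (m : ℝ) ^ 2 / (6 * δ) := by
  rw [one_lt_div (by positivity)]
  have h1 : (1 : ℝ) ≤ n := by exact_mod_cast hn
  have h2 : (1 : ℝ) ≤ (m : ℝ) ^ 2 := one_le_pow₀ (by exact_mod_cast hm)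
  have h3 : 9 ≤ Real.pi ^ 2 := by nlinarith [Real.pi_gt_three]
  have h4 : 1 * 9 ≤ n * Real.pi ^ 2 := mul_le_mul h1 h3 (by norm_num) (by positivity)
  nlinarith

theorem monotone_stdWidth {n : ℕ} {δ : ℝ} (hn : 1 ≤ n) (hδ₀ : 0 < δ) :
    Monotone (stdWidth n δ) := by
  intro k m hkm
  -- At `0` the width is `0`, by the convention `Real.log 0 = 0`.
  rcases Nat.eq_zero_or_pos k with rfl | hk
  · simp only [stdWidth, Nat.cast_zero, ne_eq, OfNat.ofNat_ne_zero, not_false_eq_true, zero_pow,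
      mul_zero, zero_div, Real.log_zero, Real.sqrt_zero]
    exact Real.sqrt_nonneg _
  · refine Real.sqrt_le_sqrt (Real.log_le_log (by positivity) ?_)
    gcongr

theorem stdWidth_pos {n : ℕ} {δ : ℝ} (hn : 1 ≤ n) (hδ₀ : 0 < δ) (hδ₁ : δ < 1) (m : ℕ)
    (hm : 1 ≤ m) : 0 < stdWidth n δ m :=
  Real.sqrt_pos.2 (Real.log_pos (one_lt_stdWidth_arg hn hδ₀ hδ₁ hm))

/-- The exponential equals `(6 * δ / (n * π ^ 2 * m ^ 2)) ^ 4`, so even with the factor `m` the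
terms are dominated by a multiple of `1 / m ^ 2`. The sum of the latter is `216 * δ ^ 4 / (n ^ 4 * π
^ 6)`, and `216 / π ^ 6 < 0.23`. -/
theorem tsum_exp_stdWidth_le {n : ℕ} {δ : ℝ} (hn : 1 ≤ n) (hδ₀ : 0 < δ) (hδ₁ : δ < 1) :
    ∑' m : ℕ, m * ENNReal.ofReal (Real.exp (-(4 * stdWidth n δ m ^ 2)))
      ≤ ENNReal.ofReal (23 / 100 * δ / n) := by
  have hn' : (1 : ℝ) ≤ n := by exact_mod_cast hn
  set c := (6 * δ / (n * Real.pi ^ 2)) ^ 4 with hc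
  have hc0 : 0 ≤ c := by positivity
  have hterm : ∀ m : ℕ, m * ENNReal.ofReal (Real.exp (-(4 * stdWidth n δ m ^ 2)))
      ≤ ENNReal.ofReal (c * (1 / (m : ℝ) ^ 2)) := by
    intro m
    rcases Nat.eq_zero_or_pos m with rfl | hm
    · simp
    rw [← ENNReal.ofReal_natCast, ← ENNReal.ofReal_mul (Nat.cast_nonneg _)]
    refine ENNReal.ofReal_le_ofReal ?_
    have h1 := one_lt_stdWidth_arg hn hδ₀ hδ₁ hm
    have hm' : (1 : ℝ) ≤ m := by exact_mod_cast hm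
    have hexp : Real.exp (-(4 * stdWidth n δ m ^ 2)) = c * (1 / (m : ℝ) ^ 8) := by
      rw [stdWidth, Real.sq_sqrt (Real.log_pos h1).le, Real.exp_neg,
        show (4 : ℝ) * Real.log (n * Real.pi ^ 2 * (m : ℝ) ^ 2 / (6 * δ))
          = ((4 : ℕ) : ℝ) * Real.log (n * Real.pi ^ 2 * (m : ℝ) ^ 2 / (6 * δ)) by norm_num,
        Real.exp_nat_mul, Real.exp_log (one_pos.trans h1), hc]
      field_simp
    rw [hexp, mul_left_comm]
    refine mul_le_mul_of_nonneg_left ?_ hc0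
    rw [mul_one_div, div_le_div_iff₀ (by positivity) (by positivity)]
    have : (m : ℝ) ^ 3 ≤ m ^ 8 := pow_le_pow_right₀ hm' (by norm_num)
    linarith
  have hs := hasSum_zeta_two.mul_left c
  refine (ENNReal.tsum_le_tsum hterm).trans ?_
  rw [← ENNReal.ofReal_tsum_of_nonneg (fun m => by positivity) hs.summable, hs.tsum_eq]
  refine ENNReal.ofReal_le_ofReal ?_
  have hpi : 9.85 ≤ Real.pi ^ 2 := by nlinarith [Real.pi_gt_d2]
  have h3 : (9.85 : ℝ) ^ 3 ≤ (Real.pi ^ 2) ^ 3 := pow_le_pow_left₀ (by norm_num) hpi 3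
  have hδ3 : δ ^ 3 ≤ 1 := pow_le_one₀ hδ₀.le hδ₁.le
  have hn3 : (1 : ℝ) ≤ (n : ℝ) ^ 3 := one_le_pow₀ hn'
  have : c * (Real.pi ^ 2 / 6) = δ / n * (216 * δ ^ 3 / ((n : ℝ) ^ 3 * (Real.pi ^ 2) ^ 3)) := by
    rw [hc]; field_simp; norm_num
  rw [this, show 23 / 100 * δ / n = δ / n * (23 / 100) by ring]
  refine mul_le_mul_of_nonneg_left ?_ (by positivity)
  rw [div_le_iff₀ (by positivity)]
  have : 1 * (9.85 : ℝ) ^ 3 ≤ (n : ℝ) ^ 3 * (Real.pi ^ 2) ^ 3 :=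
    mul_le_mul hn3 h3 (by norm_num) (by positivity)
  norm_num at this ⊢
  linarith

namespace Model

variable {n : ℕ} {M : Model n}

theorem Valid.load_pos (hM : M.Valid) (t : ℕ) (i : Fin n) : 0 < M.load (t + 1) i :=
  hM.loadMin_pos.trans (hM.load_mem (t + 1) i (Nat.le_add_left _ _)).1

theorem Valid.sgc_pos (hM : M.Valid) (t : ℕ) (i : Fin n) : 0 < M.sgc (t + 1) i :=
  hM.sgcMin_pos.trans (hM.sgc_mem (t + 1) i (Nat.le_add_left _ _)).1

theorem Valid.theta_pos (hM : M.Valid) (i : Fin n) : 0 < M.theta i :=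
  hM.thetaMin_pos.trans_le (hM.thetaMin_le i)

theorem Valid.one_le (hM : M.Valid) : 1 ≤ n := by
  rcases Nat.eq_zero_or_pos n with rfl | h
  · simpa using hM.entitl_sum
  · exact h

theorem Valid.link_growth (hM : M.Valid) (x y : ℝ) (hx : 0 ≤ x) (hxy : x ≤ y) :
    M.kappa * (y - x) ≤ M.link y - M.link x :=
  mul_sub_le_link_sub hM.link_diff hM.kappa_le hx hxy

theorem Valid.unitDemand_nonneg (hM : M.Valid) (i : Fin n) : 0 ≤ M.unitDemand i :=
  div_nonneg (linkInv_nonneg _ _) (hM.theta_pos i).le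

theorem Valid.demand_nonneg (hM : M.Valid) (t : ℕ) (i : Fin n) : 0 ≤ M.demand (t + 1) i :=
  mul_nonneg (hM.load_pos t i).le (hM.unitDemand_nonneg i)

end Model

theorem thetaLower_pos {μ : ℝ → ℝ} {p κ : ℝ} (hp : 0 < p) (n : ℕ) (δ : ℝ) (D : Finset ℕ)
    (a v σ X : ℕ → ℝ) : 0 < thetaLower μ p κ n δ D a v σ X :=
  hp.trans_le (le_max_left _ _)

theorem unitDemandUpper_nonneg {μ : ℝ → ℝ} {p κ : ℝ} (hp : 0 < p) (n : ℕ) (δ : ℝ) (D : Finset ℕ)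
    (α : ℝ) (a v σ X : ℕ → ℝ) : 0 ≤ unitDemandUpper μ p κ n δ D α a v σ X :=
  div_nonneg (linkInv_nonneg _ _) (thetaLower_pos hp n δ D a v σ X).le

namespace Run

variable {n : ℕ} {M : Model n} {δ : ℝ} {H : Set (Fin n)} {Ω : Type*} [mΩ : MeasurableSpace Ω]
  {P : Measure Ω} (R : Run M δ H P)

/-- The demand that the mechanism uses for agent `j`. -/
def usedDemand (t : ℕ) (ω : Ω) (j : Fin n) : ℝ :=
  R.repLoad t j ω * unitDemandUpper M.link M.thetaMin M.kappa n δ (Finset.Ico 1 t)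
    (R.repThresh j ω) (fun s => R.alloc s j ω) (fun s => R.repLoad s j ω)
    (fun s => R.repSgc s j ω) (fun s => R.repReward s j ω)

theorem usedDemand_nonneg (hM : M.Valid) {t : ℕ} (ht : 1 ≤ t) (ω : Ω) (j : Fin n) :
    0 ≤ R.usedDemand t ω j := by
  obtain ⟨t, rfl⟩ := Nat.exists_eq_add_of_le' ht
  exact mul_nonneg (R.repLoad_pos t j ω).le (unitDemandUpper_nonneg hM.thetaMin_pos _ _ _ _ _ _ _ _)

theorem exists_isWaterFilling (hM : M.Valid) {t : ℕ} (ht : 2 ≤ t) (ω : Ω) :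
    ∃ c, IsWaterFilling M.entitl (R.usedDemand t ω) (fun i => R.alloc t i ω) c := by
  obtain ⟨c, hc⟩ := exists_isWaterFilling_mmf (d := R.usedDemand t ω) hM.entitl_pos hM.entitl_sum
  refine ⟨c, ?_⟩
  convert hc using 1
  exact funext fun i => R.alloc_step t ht i ω

theorem alloc_nonneg (hM : M.Valid) (t : ℕ) (i : Fin n) (ω : Ω) : 0 ≤ R.alloc (t + 1) i ω := by
  rcases Nat.eq_zero_or_pos t with rfl | ht
  · rw [R.alloc_one]; exact (hM.entitl_pos i).le
  · obtain ⟨c, hc⟩ := R.exists_isWaterFilling hM (t := t + 1) (by omega) ω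
    exact hc.nonneg hM.entitl_pos (R.usedDemand_nonneg hM (by omega) ω) i

theorem sum_alloc_le (hM : M.Valid) (t : ℕ) (ω : Ω) : ∑ i, R.alloc (t + 1) i ω ≤ 1 := by
  rcases Nat.eq_zero_or_pos t with rfl | ht
  · simp only [zero_add, R.alloc_one, hM.entitl_sum, le_refl]
  · obtain ⟨c, hc⟩ := R.exists_isWaterFilling hM (t := t + 1) (by omega) ω
    exact hc.sum_le

theorem alloc_le_one (hM : M.Valid) (t : ℕ) (i : Fin n) (ω : Ω) : R.alloc (t + 1) i ω ≤ 1 :=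
  (Finset.single_le_sum (f := fun i => R.alloc (t + 1) i ω)
    (fun j _ => R.alloc_nonneg hM t j ω) (Finset.mem_univ i)).trans (R.sum_alloc_le hM t ω)

/-- The allocation to agent `i` on round `k + 1`, per unit load and sub-Gaussian constant. -/
def weight (i : Fin n) (k : ℕ) (ω : Ω) : ℝ :=
  R.alloc (k + 1) i ω / (M.load (k + 1) i * M.sgc (k + 1) i)

/-- The normalised noise in the reward of agent `i` on round `k + 1`. -/
def noise (i : Fin n) (k : ℕ) (ω : Ω) : ℝ :=
  (R.reward (k + 1) i ω - M.payoff i (R.alloc (k + 1) i ω / M.load (k + 1) i)) / M.sgc (k + 1) i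

/-- At `ω`, the noise in the data of agent `i` is always within the confidence width. -/
def IsConfident (i : Fin n) (ω : Ω) : Prop :=
  ∀ m, |∑ k ∈ Finset.range m, R.weight i k ω * R.noise i k ω|
    ≤ 5 * stdWidth n δ m * √(∑ k ∈ Finset.range m, R.weight i k ω ^ 2)

/-- A version of the noise that is measurable with respect to the filtration. -/
def noiseVersion (i : Fin n) (k : ℕ) (ω : Ω) : ℝ :=
  (R.reward (k + 1) i ω - P[R.reward (k + 1) i | R.ℱ k] ω) / M.sgc (k + 1) i

/-- A version of the weight that is measurable with respect to the filtration. -/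
def weightVersion (i : Fin n) : ℕ → Ω → ℝ
  -- The first weight is a positive constant, so it is nonzero at every `ω`, as the self-normalised
  -- bound requires.
  | 0, _ => M.entitl i / (M.load 1 i * M.sgc 1 i)
  | k + 1, ω => linkInv M.link (P[R.reward (k + 2) i | R.ℱ (k + 1)] ω)
      / (M.theta i * M.sgc (k + 2) i)

theorem noiseVersion_ae_eq (i : Fin n) (k : ℕ) : R.noiseVersion i k =ᵐ[P] R.noise i k := by
  filter_upwards [R.reward_mean k i] with ω hω
  simp only [noiseVersion, noise, hω]

/-- Measurability of the allocation, which involves an argmin, is never checked: the allocation is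
recovered almost surely from the conditional mean `μ (a * θ / v)` of the reward by inverting `μ`. -/
theorem weightVersion_ae_eq (hM : M.Valid) (i : Fin n) (k : ℕ) :
    R.weightVersion i k =ᵐ[P] R.weight i k := by
  cases k with
  | zero => exact Eventually.of_forall fun ω => by simp [weightVersion, weight, R.alloc_one]
  | succ k =>
    filter_upwards [R.reward_mean (k + 1) i] with ω hω
    have hv := hM.load_pos (k + 1) i
    have hθ := hM.theta_pos i
    simp only [weightVersion, weight, hω, Model.payoff]
    rw [linkInv_link hM.kappa_pos hM.link_growth
      (mul_nonneg (div_nonneg (R.alloc_nonneg hM (k + 1) i ω) hv.le) hθ.le)]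
    have := hM.sgc_pos (k + 1) i
    field_simp

theorem measurable_weightVersion (hM : M.Valid) (i : Fin n) (k : ℕ) :
    Measurable[R.ℱ k] (R.weightVersion i k) := by
  cases k with
  | zero => exact measurable_const
  | succ k =>
    exact ((monotone_linkInv hM.kappa_pos hM.link_growth).measurable.comp
      stronglyMeasurable_condExp.measurable).div_const _

theorem isSubgaussianNoise (hM : M.Valid) [IsProbabilityMeasure P] (i : Fin n) :
    IsSubgaussianNoise P R.ℱ (R.noiseVersion i) where
  meas k := ((R.reward_meas k i).sub (stronglyMeasurable_condExp.measurable.mono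
    (R.ℱ.mono (Nat.le_succ k)) le_rfl)).div_const _
  setLIntegral_le k v B hB := by
    have hσ := hM.sgc_pos k i
    have hBm : MeasurableSet B := R.ℱ.le k B hB
    set l := v / M.sgc (k + 1) i with hl
    set f : Ω → ℝ := fun ω => Real.exp
      (l * (R.reward (k + 1) i ω - M.payoff i (R.alloc (k + 1) i ω / M.load (k + 1) i))) with hf
    have hfi : Integrable f P := R.reward_exp_integrable k i l
    have h1 : ∫ ω in B, f ω ∂P ≤ Real.exp (v ^ 2 / 2) * P.real B := by
      rw [← setIntegral_condExp (R.ℱ.le k) hfi hB]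
      calc _ ≤ ∫ _ in B, Real.exp (l ^ 2 * M.sgc (k + 1) i ^ 2 / 2) ∂P :=
            setIntegral_mono_ae integrable_condExp.integrableOn (integrable_const _)
              (R.reward_subgaussian k i l)
        _ = _ := by
            rw [setIntegral_const, smul_eq_mul, mul_comm, hl, div_pow,
              div_mul_cancel₀ _ (by positivity)]
    calc ∫⁻ ω in B, ENNReal.ofReal (Real.exp (v * R.noiseVersion i k ω - v ^ 2 / 2)) ∂P
        = ∫⁻ ω in B, ENNReal.ofReal (Real.exp (-(v ^ 2 / 2)) * f ω) ∂P := by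
          refine setLIntegral_congr_fun_ae hBm ?_
          filter_upwards [R.noiseVersion_ae_eq i k] with ω hω _
          rw [hω, hf, ← Real.exp_add, noise, hl]
          congr 2
          ring
      _ = ENNReal.ofReal (∫ ω in B, Real.exp (-(v ^ 2 / 2)) * f ω ∂P) :=
          (ofReal_integral_eq_lintegral_ofReal (hfi.integrableOn.const_mul _)
            (Eventually.of_forall fun ω => by positivity)).symm
      _ ≤ ENNReal.ofReal (P.real B) := by
          refine ENNReal.ofReal_le_ofReal ?_
          rw [integral_const_mul]
          refine (mul_le_mul_of_nonneg_left h1 (Real.exp_pos _).le).trans (le_of_eq ?_)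
          rw [← mul_assoc, ← Real.exp_add, neg_add_cancel, Real.exp_zero, one_mul]
      _ = P B := ofReal_measureReal

/-- `IsConfident` involves only true rewards, loads and sub-Gaussian constants, so the bound holds
for untruthful agents too. The two signs of the noise cost `0.23 * δ / n` each. -/
theorem measure_not_isConfident_le (hM : M.Valid) (hδ₀ : 0 < δ) (hδ₁ : δ < 1)
    [IsProbabilityMeasure P] (i : Fin n) :
    P {ω | ¬ R.IsConfident i ω} ≤ ENNReal.ofReal (46 / 100 * δ / n) := by
  have hn := hM.one_le
  have hx0 : ∀ ω, R.weightVersion i 0 ω ≠ 0 := fun ω =>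
    (div_pos (hM.entitl_pos i) (mul_pos (hM.load_pos 0 i) (hM.sgc_pos 0 i))).ne'
  have hp := (R.isSubgaussianNoise hM i).measure_exists_lt_le (R.measurable_weightVersion hM i)
    hx0 (monotone_stdWidth hn hδ₀) (stdWidth_pos hn hδ₀ hδ₁)
  have hq := (R.isSubgaussianNoise hM i).neg.measure_exists_lt_le
    (R.measurable_weightVersion hM i) hx0 (monotone_stdWidth hn hδ₀) (stdWidth_pos hn hδ₀ hδ₁)
  have htot := tsum_exp_stdWidth_le hn hδ₀ hδ₁
  have hae : ∀ᵐ ω ∂P, ∀ k, R.noiseVersion i k ω = R.noise i k ω ∧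
      R.weightVersion i k ω = R.weight i k ω :=
    ae_all_iff.2 fun k => (R.noiseVersion_ae_eq i k).and (R.weightVersion_ae_eq hM i k)
  refine (measure_mono_ae ?_).trans ((measure_union_le _ _).trans
    ((add_le_add (hp.trans htot) (hq.trans htot)).trans (le_of_eq ?_)))
  · filter_upwards [hae] with ω hω hbad
    simp only [IsConfident, not_forall, not_le] at hbad
    obtain ⟨m, hm⟩ := hbad
    rcases lt_abs.1 hm with h | h
    · refine Or.inl ⟨m, ?_⟩
      simpa only [hω] using h
    · refine Or.inr ⟨m, ?_⟩
      simpa only [hω, mul_neg, Finset.sum_neg_distrib] using h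
  · rw [← ENNReal.ofReal_add (by positivity) (by positivity)]
    congr 1; ring

theorem measure_exists_not_isConfident_le (hM : M.Valid) (hδ₀ : 0 < δ) (hδ₁ : δ < 1)
    [IsProbabilityMeasure P] :
    P {ω | ∃ i, ¬ R.IsConfident i ω} ≤ ENNReal.ofReal (46 / 100 * δ) := by
  have hn : (0 : ℝ) < n := by exact_mod_cast hM.one_le
  have : {ω | ∃ i, ¬ R.IsConfident i ω} = ⋃ i, {ω | ¬ R.IsConfident i ω} := by
    ext ω; simp
  rw [this]
  refine (measure_iUnion_fintype_le _ _).trans ((Finset.sum_le_sum fun i _ =>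
    R.measure_not_isConfident_le hM hδ₀ hδ₁ i).trans (le_of_eq ?_))
  rw [Finset.sum_const, Finset.card_univ, Fintype.card_fin, nsmul_eq_mul,
    ← ENNReal.ofReal_natCast, ← ENNReal.ofReal_mul hn.le]
  congr 1; field_simp

end Run

/-! ### The sum of the widths of the confidence intervals -/

/-- This is where `C₂` comes from. For `y ≤ c`, Bernoulli's inequality `(1 + c ^ 2) ^ ((y / c) ^ 2)
≤ 1 + y ^ 2` gives the claim; for `y ≥ c`, the right side is at least `1`. -/
theorem min_one_div_le {c y : ℝ} (hc : 0 < c) (hy : 0 ≤ y) :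
    min 1 (y / c) ≤ 1 / √(Real.log (1 + c ^ 2)) * √(Real.log (1 + y ^ 2)) := by
  have hlog : 0 < Real.log (1 + c ^ 2) := Real.log_pos (by have := pow_pos hc 2; linarith)
  have hs : 0 < √(Real.log (1 + c ^ 2)) := Real.sqrt_pos.2 hlog
  rw [one_div, ← div_eq_inv_mul, le_div_iff₀ hs]
  rcases le_total c y with h | h
  · rw [min_eq_left ((one_le_div hc).2 h), one_mul]
    refine Real.sqrt_le_sqrt (Real.log_le_log (by positivity) ?_)
    gcongr
  · have h1 : y / c ≤ 1 := (div_le_one hc).2 h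
    rw [min_eq_right h1]
    have h0 : 0 ≤ y / c := div_nonneg hy hc.le
    refine Real.le_sqrt_of_sq_le ?_
    rw [mul_pow, Real.sq_sqrt hlog.le, ← Real.log_rpow (by positivity)]
    refine Real.log_le_log (Real.rpow_pos_of_pos (by positivity) _) ?_
    refine (rpow_one_add_le_one_add_mul_self (by have := sq_nonneg c; linarith) (by positivity)
      (pow_le_one₀ h0 h1)).trans (le_of_eq ?_)
    rw [div_pow, div_mul_cancel₀ _ (by positivity)]

/-- Telescoping: with `S m` the sum of the first `m` squares, `1 + x m ^ 2 / S m = S (m + 1) / S m`.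
-/
theorem sum_log_one_add_div_eq {x : ℕ → ℝ} (hx : x 0 ≠ 0) {T : ℕ} (hT : 1 ≤ T) :
    ∑ m ∈ Finset.Ico 1 T, Real.log (1 + x m ^ 2 / ∑ k ∈ Finset.range m, x k ^ 2)
      = Real.log ((∑ k ∈ Finset.range T, x k ^ 2) / x 0 ^ 2) := by
  have hpos : ∀ m, 1 ≤ m → 0 < ∑ k ∈ Finset.range m, x k ^ 2 := fun m hm =>
    (by positivity : 0 < x 0 ^ 2).trans_le (Finset.single_le_sum (f := fun k => x k ^ 2)
      (fun k _ => sq_nonneg _) (Finset.mem_range.2 hm))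
  induction T, hT using Nat.le_induction with
  | base => simp [hx]
  | succ T hT ih =>
    have h1 := hpos T hT
    have h2 := hpos (T + 1) (by omega)
    have h0 : (0 : ℝ) < x 0 ^ 2 := by positivity
    rw [Finset.sum_Ico_succ_top hT, ih, ← Real.log_mul (by positivity) (by positivity)]
    congr 1
    rw [Finset.sum_range_succ]
    field_simp

theorem sum_sqrt_le_sqrt_mul_sqrt {f : ℕ → ℝ} {T : ℕ} (hf : ∀ m ∈ Finset.Ico 1 T, 0 ≤ f m) :
    ∑ m ∈ Finset.Ico 1 T, √(f m) ≤ √T * √(∑ m ∈ Finset.Ico 1 T, f m) := by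
  have h := Real.sum_mul_le_sqrt_mul_sqrt (Finset.Ico 1 T) (fun _ => 1) (fun m => √(f m))
  simp only [one_mul, one_pow, Finset.sum_const, Nat.card_Ico, nsmul_eq_mul, mul_one] at h
  rw [Finset.sum_congr rfl fun m hm => Real.sq_sqrt (hf m hm)] at h
  refine h.trans (mul_le_mul_of_nonneg_right (Real.sqrt_le_sqrt ?_) (Real.sqrt_nonneg _))
  exact_mod_cast Nat.sub_le T 1

namespace Model

variable {n : ℕ} {M : Model n}

theorem Valid.loadMax_pos (hM : M.Valid) : 0 < M.loadMax :=
  (hM.load_pos 0 ⟨0, hM.one_le⟩).trans_le (hM.load_mem 1 _ le_rfl).2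

theorem Valid.sgcMax_pos (hM : M.Valid) : 0 < M.sgcMax :=
  (hM.sgc_pos 0 ⟨0, hM.one_le⟩).trans_le (hM.sgc_mem 1 _ le_rfl).2

theorem Valid.C₁_pos (hM : M.Valid) : 0 < M.C₁ := by
  have := hM.loadMax_pos
  have := hM.sgcMax_pos
  exact div_pos hM.thetaMin_pos (by positivity)

theorem C₂_nonneg (M : Model n) : 0 ≤ M.C₂ := one_div_nonneg.2 (Real.sqrt_nonneg _)

theorem Valid.iInf_entitl_pos (hM : M.Valid) : 0 < ⨅ i, M.entitl i := by
  have : Nonempty (Fin n) := ⟨⟨0, hM.one_le⟩⟩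
  obtain ⟨i, hi⟩ := exists_eq_ciInf_of_finite (f := M.entitl)
  rw [← hi]; exact hM.entitl_pos i

theorem iInf_entitl_le (M : Model n) (i : Fin n) : ⨅ i, M.entitl i ≤ M.entitl i :=
  ciInf_le (Set.finite_range _).bddBelow i

end Model

namespace Run

variable {n : ℕ} {M : Model n} {δ : ℝ} {H : Set (Fin n)} {Ω : Type*} [mΩ : MeasurableSpace Ω]
  {P : Measure Ω} (R : Run M δ H P)

theorem weight_zero_pos (hM : M.Valid) (i : Fin n) (ω : Ω) : 0 < R.weight i 0 ω := by
  simp only [weight, zero_add, R.alloc_one]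
  exact div_pos (hM.entitl_pos i) (mul_pos (hM.load_pos 0 i) (hM.sgc_pos 0 i))

theorem sum_weight_sq_pos (hM : M.Valid) (i : Fin n) (ω : Ω) {m : ℕ} (hm : 1 ≤ m) :
    0 < ∑ k ∈ Finset.range m, R.weight i k ω ^ 2 :=
  (pow_pos (R.weight_zero_pos hM i ω) 2).trans_le
    (Finset.single_le_sum (f := fun k => R.weight i k ω ^ 2)
      (fun _ _ => sq_nonneg _) (Finset.mem_range.2 hm))

/-- The lower confidence bound for the parameter of agent `i` after `m` rounds. -/
def lowerBound (i : Fin n) (m : ℕ) (ω : Ω) : ℝ :=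
  thetaLower M.link M.thetaMin M.kappa n δ (Finset.Ico 1 (m + 1))
    (fun s => R.alloc s i ω) (fun s => R.repLoad s i ω)
    (fun s => R.repSgc s i ω) (fun s => R.repReward s i ω)

/-- For a truthful agent the noise bounds `κ * A ^ 2` times the error of the estimate, so the error
is at most `β / A`. Subtracting the width `β / A` once more gives the factor `2`. -/
theorem lowerBound_mem (hM : M.Valid) {i : Fin n} (hi : i ∈ H) {ω : Ω} (h : R.IsConfident i ω)
    {m : ℕ} (hm : 1 ≤ m) :
    R.lowerBound i m ω ≤ M.theta i ∧ M.theta i - R.lowerBound i m ω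
      ≤ 2 * betaWidth M.kappa n δ m / √(∑ k ∈ Finset.range m, R.weight i k ω ^ 2) := by
  have hκ := hM.kappa_pos
  have hsum : ∀ f : ℕ → ℝ,
      ∑ s ∈ Finset.Ico 1 (m + 1), f s = ∑ k ∈ Finset.range m, f (k + 1) := fun f => by
    rw [Finset.sum_Ico_eq_sum_range]
    exact Finset.sum_congr rfl fun k _ => by rw [add_comm]
  set A := √(∑ k ∈ Finset.range m, R.weight i k ω ^ 2) with hA
  have hApos : 0 < A := Real.sqrt_pos.2 (R.sum_weight_sq_pos hM i ω hm)
  have hnorm : dataNorm (Finset.Ico 1 (m + 1)) (fun s => R.alloc s i ω)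
      (fun s => R.repLoad s i ω) (fun s => R.repSgc s i ω) = A := by
    rw [dataNorm, hsum, hA]
    congr 1
    refine Finset.sum_congr rfl fun k _ => ?_
    rw [R.truthful_load i hi, R.truthful_sgc i hi, weight, div_pow, mul_pow]
  have hpos : ∀ s ∈ Finset.Ico 1 (m + 1), ∃ k, s = k + 1 := fun s hs =>
    Nat.exists_eq_add_of_le' (Finset.mem_Ico.1 hs).1
  have hest := abs_glmEstimate_sub_le hκ hM.link_diff.continuousOn hM.link_growth
    hM.thetaMin_pos.le (hM.thetaMin_le i) (D := Finset.Ico 1 (m + 1))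
    (a := fun s => R.alloc s i ω) (v := fun s => R.repLoad s i ω)
    (σ := fun s => R.repSgc s i ω) (X := fun s => R.repReward s i ω)
    (fun s hs => by obtain ⟨k, rfl⟩ := hpos s hs; exact R.alloc_nonneg hM k i ω)
    (fun s hs => by obtain ⟨k, rfl⟩ := hpos s hs; exact R.repLoad_pos k i ω)
    (by rw [hnorm]; exact hApos)
  rw [hnorm, hsum] at hest
  have hnoise : ∑ k ∈ Finset.range m, R.alloc (k + 1) i ω /
      (R.repLoad (k + 1) i ω * R.repSgc (k + 1) i ω ^ 2) * (R.repReward (k + 1) i ω -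
        M.link (R.alloc (k + 1) i ω / R.repLoad (k + 1) i ω * M.theta i))
      = ∑ k ∈ Finset.range m, R.weight i k ω * R.noise i k ω := by
    refine Finset.sum_congr rfl fun k _ => ?_
    rw [R.truthful_load i hi, R.truthful_sgc i hi, R.truthful_reward i hi, weight, noise,
      Model.payoff]
    have := hM.sgc_pos k i
    have := hM.load_pos k i
    field_simp
  rw [hnoise] at hest
  replace hest := hest.trans (h m)
  set est := glmEstimate M.link M.thetaMin (Finset.Ico 1 (m + 1)) (fun s => R.alloc s i ω)
    (fun s => R.repLoad s i ω) (fun s => R.repSgc s i ω) (fun s => R.repReward s i ω) with hest_def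
  have hβ : |est - M.theta i| ≤ betaWidth M.kappa n δ m / A := by
    rw [le_div_iff₀ hApos, betaWidth, div_mul_eq_mul_div, le_div_iff₀ hκ]
    refine le_of_mul_le_mul_right ?_ hApos
    calc _ = M.kappa * A ^ 2 * |est - M.theta i| := by ring
      _ ≤ _ := hest
  have hlow : R.lowerBound i m ω = max M.thetaMin (est - betaWidth M.kappa n δ m / A) := by
    rw [lowerBound, thetaLower, hnorm, Nat.card_Ico, Nat.add_sub_cancel]
  obtain ⟨h1, h2⟩ := abs_le.1 hβ
  rw [hlow]
  refine ⟨max_le (hM.thetaMin_le i) (by linarith), ?_⟩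
  have h3 := le_max_right M.thetaMin (est - betaWidth M.kappa n δ m / A)
  rw [mul_div_assoc]
  linarith

theorem usedDemand_eq {i : Fin n} (hi : i ∈ H) (m : ℕ) (ω : Ω) :
    R.usedDemand (m + 1) ω i
      = M.load (m + 1) i * (linkInv M.link (M.thresh i) / R.lowerBound i m ω) := by
  simp only [usedDemand, R.truthful_load i hi, R.truthful_thresh i hi]
  rfl

theorem lowerBound_pos (hM : M.Valid) (i : Fin n) (m : ℕ) (ω : Ω) : 0 < R.lowerBound i m ω :=
  thetaLower_pos hM.thetaMin_pos _ _ _ _ _ _ _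

theorem demand_le_usedDemand (hM : M.Valid) {i : Fin n} (hi : i ∈ H) {ω : Ω}
    (h : R.IsConfident i ω) {m : ℕ} (hm : 1 ≤ m) :
    M.demand (m + 1) i ≤ R.usedDemand (m + 1) ω i := by
  rw [R.usedDemand_eq hi, Model.demand, Model.unitDemand]
  exact mul_le_mul_of_nonneg_left (div_le_div_of_nonneg_left (linkInv_nonneg _ _)
    (R.lowerBound_pos hM i m ω) (R.lowerBound_mem hM hi h hm).1) (hM.load_pos m i).le

/-- The over-allocation to a truthful agent on a round, in terms of the width of the confidence
interval. -/
theorem alloc_sub_demand_le (hM : M.Valid) {i : Fin n} (hi : i ∈ H) {ω : Ω}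
    (h : R.IsConfident i ω) {m : ℕ} (hm : 1 ≤ m) :
    max (R.alloc (m + 1) i ω - M.demand (m + 1) i) 0 ≤ max 1 (betaWidth M.kappa n δ m) * M.C₂ *
      √(Real.log (1 + R.weight i m ω ^ 2 / ∑ k ∈ Finset.range m, R.weight i k ω ^ 2)) := by
  have hS := R.sum_weight_sq_pos hM i ω hm
  set S := ∑ k ∈ Finset.range m, R.weight i k ω ^ 2
  set β := betaWidth M.kappa n δ m
  have hβ1 : 1 ≤ max 1 β := le_max_left _ _
  have hβ2 : β ≤ max 1 β := le_max_right _ _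
  have hθ := hM.theta_pos i
  have hp := hM.thetaMin_pos
  have hv := hM.load_pos m i
  have hσ := hM.sgc_pos m i
  have hlow := R.lowerBound_pos hM i m ω
  have hd0 := hM.demand_nonneg m i
  have ha0 := R.alloc_nonneg hM m i ω
  have ha1 := R.alloc_le_one hM m i ω
  set a := R.alloc (m + 1) i ω with ha
  have hx : 0 ≤ R.weight i m ω := div_nonneg ha0 (mul_pos hv hσ).le
  have hax : a ≤ R.weight i m ω * (M.sgcMax * M.loadMax) := by
    have : a = R.weight i m ω * (M.sgc (m + 1) i * M.load (m + 1) i) := by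
      rw [weight]; field_simp; exact ha
    rw [this]
    have h1 := (hM.load_mem (m + 1) i (by omega)).2
    have h2 := (hM.sgc_mem (m + 1) i (by omega)).2
    have := hM.sgcMax_pos
    gcongr
  obtain ⟨hl1, hl2⟩ := R.lowerBound_mem hM hi h hm
  have hβ0 : 0 ≤ 2 * β / √S := (sub_nonneg.2 hl1).trans hl2
  obtain ⟨c, hc⟩ := R.exists_isWaterFilling hM (t := m + 1) (by omega) ω
  have hau : a * R.lowerBound i m ω ≤ M.demand (m + 1) i * M.theta i := by
    have h1 : a ≤ R.usedDemand (m + 1) ω i := hc.le_demand i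
    rw [R.usedDemand_eq hi] at h1
    refine (mul_le_mul_of_nonneg_right h1 hlow.le).trans (le_of_eq ?_)
    rw [Model.demand, Model.unitDemand]
    field_simp
  -- By `hau`, `(a - d) * θ ≤ a * (θ - lower bound)`. The error is thus proportional to the
  -- allocation, which is also what the round adds to the data; this is why the sum over rounds
  -- telescopes.
  have hdiff : a - M.demand (m + 1) i ≤ max 1 β * (R.weight i m ω / √S / M.C₁) := by
    have h2 : (a - M.demand (m + 1) i) * M.theta i ≤ a * (2 * β / √S) := by
      have := mul_le_mul_of_nonneg_left hl2 ha0
      linarith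
    have h3 : a - M.demand (m + 1) i ≤ a * (2 * β / √S) / M.thetaMin :=
      ((le_div_iff₀ hθ).2 h2).trans (div_le_div_of_nonneg_left (mul_nonneg ha0 hβ0) hp
        (hM.thetaMin_le i))
    refine h3.trans ?_
    have h4 : a * (2 * β / √S) ≤
        R.weight i m ω * (M.sgcMax * M.loadMax) * (2 * max 1 β / √S) := by
      refine mul_le_mul hax ?_ hβ0 (ha0.trans hax)
      gcongr
    refine (div_le_div_of_nonneg_right h4 hp.le).trans (le_of_eq ?_)
    rw [Model.C₁]
    have := hM.sgcMax_pos
    have := hM.loadMax_pos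
    have := Real.sqrt_pos.2 hS
    field_simp
  have hmin : max (a - M.demand (m + 1) i) 0
      ≤ max 1 β * min 1 (R.weight i m ω / √S / M.C₁) := by
    have hC := hM.C₁_pos
    rw [mul_min_of_nonneg _ _ (zero_le_one.trans hβ1)]
    refine max_le (le_min (by linarith) hdiff) ?_
    have : 0 ≤ max 1 β := zero_le_one.trans hβ1
    positivity
  refine hmin.trans ?_
  rw [mul_assoc]
  refine mul_le_mul_of_nonneg_left ?_ (zero_le_one.trans hβ1)
  refine (min_one_div_le hM.C₁_pos (by positivity)).trans (le_of_eq ?_)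
  rw [div_pow, Real.sq_sqrt hS.le, Model.C₂]

/-- The telescoped sum is the logarithm of the total of the squared weights over the first one.
Allocating entitlements on round `1` keeps that first weight away from `0`; `C₃` collects the
bounds. -/
theorem sum_log_weight_le (hM : M.Valid) (i : Fin n) (ω : Ω) {T : ℕ} (hT : 1 ≤ T) :
    ∑ m ∈ Finset.Ico 1 T,
      Real.log (1 + R.weight i m ω ^ 2 / ∑ k ∈ Finset.range m, R.weight i k ω ^ 2)
      ≤ Real.log (M.C₃ * T) := by
  have h0 := R.weight_zero_pos hM i ω
  rw [sum_log_one_add_div_eq (x := fun k => R.weight i k ω) h0.ne' hT]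
  have hS := R.sum_weight_sq_pos hM i ω hT
  refine Real.log_le_log (by positivity) ?_
  have hvm := hM.loadMin_pos
  have hσm := hM.sgcMin_pos
  have hvM := hM.loadMax_pos
  have hσM := hM.sgcMax_pos
  have he := hM.iInf_entitl_pos
  have hup : ∑ k ∈ Finset.range T, R.weight i k ω ^ 2 ≤ T * (1 / (M.loadMin * M.sgcMin)) ^ 2 := by
    refine (Finset.sum_le_card_nsmul _ _ ((1 / (M.loadMin * M.sgcMin)) ^ 2)
      fun k _ => ?_).trans (le_of_eq ?_)
    · have hv := hM.load_pos k i
      have hσ := hM.sgc_pos k i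
      have ha := R.alloc_nonneg hM k i ω
      have h1 := R.alloc_le_one hM k i ω
      have h2 := (hM.load_mem (k + 1) i (by omega)).1.le
      have h3 := (hM.sgc_mem (k + 1) i (by omega)).1.le
      rw [weight]
      gcongr
    · rw [Finset.card_range, nsmul_eq_mul]
  have hlo : (⨅ i, M.entitl i) / (M.loadMax * M.sgcMax) ≤ R.weight i 0 ω := by
    have h1 := M.iInf_entitl_le i
    have hv := hM.load_pos 0 i
    have hσ := hM.sgc_pos 0 i
    have h2 := (hM.load_mem 1 i le_rfl).2
    have h3 := (hM.sgc_mem 1 i le_rfl).2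
    have := (hM.entitl_pos i).le
    simp only [weight, zero_add, R.alloc_one] at hv hσ ⊢
    gcongr
  calc _ ≤ T * (1 / (M.loadMin * M.sgcMin)) ^ 2
        / ((⨅ i, M.entitl i) / (M.loadMax * M.sgcMax)) ^ 2 := by gcongr
    _ = M.C₃ * T := by rw [Model.C₃]; field_simp

theorem monotone_betaWidth (hM : M.Valid) (hδ₀ : 0 < δ) : Monotone (betaWidth M.kappa n δ) :=
  fun _ _ h => mul_le_mul_of_nonneg_left (monotone_stdWidth hM.one_le hδ₀ h)
    (div_nonneg (by norm_num) hM.kappa_pos.le)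

/-- The total over-allocation to a truthful agent after the first round. -/
theorem sum_alloc_sub_demand_le (hM : M.Valid) (hδ₀ : 0 < δ) {i : Fin n} (hi : i ∈ H) {ω : Ω}
    (h : R.IsConfident i ω) (T : ℕ) :
    ∑ m ∈ Finset.Ico 1 T, max (R.alloc (m + 1) i ω - M.demand (m + 1) i) 0
      ≤ M.C₂ * max 1 (betaWidth M.kappa n δ (T - 1)) * √T * √(Real.log (M.C₃ * T)) := by
  have hC := M.C₂_nonneg
  have hβ1 : 0 ≤ max 1 (betaWidth M.kappa n δ (T - 1)) := zero_le_one.trans (le_max_left _ _)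
  rcases Nat.eq_zero_or_pos T with rfl | hT
  · simp
  have hlog : ∀ m ∈ Finset.Ico 1 T, 0 ≤ Real.log
      (1 + R.weight i m ω ^ 2 / ∑ k ∈ Finset.range m, R.weight i k ω ^ 2) := fun m hm =>
    Real.log_nonneg (by
      have := R.sum_weight_sq_pos hM i ω (Finset.mem_Ico.1 hm).1
      have : 0 ≤ R.weight i m ω ^ 2 / ∑ k ∈ Finset.range m, R.weight i k ω ^ 2 := by positivity
      linarith)
  calc _ ≤ ∑ m ∈ Finset.Ico 1 T, M.C₂ * max 1 (betaWidth M.kappa n δ (T - 1)) *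
        √(Real.log (1 + R.weight i m ω ^ 2 / ∑ k ∈ Finset.range m, R.weight i k ω ^ 2)) := by
        refine Finset.sum_le_sum fun m hm => ?_
        rw [Finset.mem_Ico] at hm
        refine (R.alloc_sub_demand_le hM hi h hm.1).trans ?_
        rw [mul_comm M.C₂]
        gcongr
        exact monotone_betaWidth hM hδ₀ (by omega)
    _ ≤ M.C₂ * max 1 (betaWidth M.kappa n δ (T - 1)) * (√T * √(∑ m ∈ Finset.Ico 1 T,
        Real.log (1 + R.weight i m ω ^ 2 / ∑ k ∈ Finset.range m, R.weight i k ω ^ 2))) := by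
        rw [← Finset.mul_sum]
        exact mul_le_mul_of_nonneg_left (sum_sqrt_le_sqrt_mul_sqrt hlog) (mul_nonneg hC hβ1)
    _ ≤ M.C₂ * max 1 (betaWidth M.kappa n δ (T - 1)) * (√T * √(Real.log (M.C₃ * T))) := by
        gcongr
        exact R.sum_log_weight_le hM i ω hT
    _ = _ := by ring

end Run

/-! ### Efficiency, fairness and incentives on the event that the bounds hold -/

theorem sum_Icc_one_eq_sum_range (f : ℕ → ℝ) (T : ℕ) :
    ∑ t ∈ Finset.Icc 1 T, f t = ∑ m ∈ Finset.range T, f (m + 1) := by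
  induction T with
  | zero => simp
  | succ T ih => rw [Finset.sum_Icc_succ_top (by omega), ih, Finset.sum_range_succ]

theorem lossLOT_nonneg {n : ℕ} {d a : Fin n → ℝ} (ha : ∑ i, a i ≤ 1) : 0 ≤ lossLOT d a :=
  le_min (add_nonneg (sub_nonneg.2 ha) (Finset.sum_nonneg fun _ _ => le_max_right _ _))
    (Finset.sum_nonneg fun _ _ => le_max_right _ _)

namespace Model

variable {n : ℕ} {M : Model n}

theorem Valid.util_min (hM : M.Valid) (i : Fin n) (x : ℝ) :
    M.util i (min x (M.unitDemand i)) = M.util i x := by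
  rcases le_total x (M.unitDemand i) with h | h
  · rw [min_eq_left h]
  · rw [min_eq_right h, hM.util_const i x h]

theorem Valid.util_mono (hM : M.Valid) (i : Fin n) {x y : ℝ} (hx : 0 ≤ x) (hxy : x ≤ y) :
    M.util i x ≤ M.util i y := by
  rw [← hM.util_min i x, ← hM.util_min i y]
  have hu := hM.unitDemand_nonneg i
  exact (hM.util_strictMono i).monotoneOn ⟨le_min hx hu, min_le_right _ _⟩
    ⟨le_min (hx.trans hxy) hu, min_le_right _ _⟩ (min_le_min_right _ hxy)

/-- Allocations may be truncated at the demand, which is the form in which the water-filling lemmas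
compare them. -/
theorem Valid.util_min_demand (hM : M.Valid) (i : Fin n) (t : ℕ) (a : ℝ) :
    M.util i (min a (M.demand (t + 1) i) / M.load (t + 1) i)
      = M.util i (a / M.load (t + 1) i) := by
  have hv := hM.load_pos t i
  rw [← hM.util_min i (a / M.load (t + 1) i), ← min_div_div_right hv.le, Model.demand,
    mul_div_cancel_left₀ _ hv.ne']

end Model

namespace Run

variable {n : ℕ} {M : Model n} {δ : ℝ} {H : Set (Fin n)} {Ω : Type*} [mΩ : MeasurableSpace Ω]
  {P : Measure Ω}

theorem loss_nonneg (R : Run M δ H P) (hM : M.Valid) (T : ℕ) (ω : Ω) : 0 ≤ R.loss T ω := by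
  rw [loss, sum_Icc_one_eq_sum_range]
  exact Finset.sum_nonneg fun m _ => lossLOT_nonneg (R.sum_alloc_le hM m ω)

theorem loss_le_lossBound (R : Run M δ Set.univ P) (hM : M.Valid) (hδ₀ : 0 < δ) {ω : Ω}
    (h : ∀ i, R.IsConfident i ω) (T : ℕ) :
    R.loss T ω ≤ lossBound M.kappa M.C₂ M.C₃ n δ T := by
  -- No confidence bound is available on round `1`; its loss is the summand `1` of `lossBound`.
  have hone : lossLOT (M.demand 1) (fun i => R.alloc 1 i ω) ≤ 1 := by
    refine (min_le_left _ _).trans ?_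
    simp only [lossUR, lossOR, R.alloc_one, hM.entitl_sum, sub_self, zero_add]
    rw [← hM.entitl_sum]
    exact Finset.sum_le_sum fun i _ => max_le
      (sub_le_self _ (hM.demand_nonneg 0 i)) (hM.entitl_pos i).le
  have hsum : ∑ m ∈ Finset.Ico 1 T, lossLOT (M.demand (m + 1)) (fun i => R.alloc (m + 1) i ω)
      ≤ n * (M.C₂ * max 1 (betaWidth M.kappa n δ (T - 1)) * √T * √(Real.log (M.C₃ * T))) := by
    calc _ ≤ ∑ m ∈ Finset.Ico 1 T, ∑ i,
          max (R.alloc (m + 1) i ω - M.demand (m + 1) i) 0 := by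
          refine Finset.sum_le_sum fun m hm => ?_
          rw [Finset.mem_Ico] at hm
          obtain ⟨c, hc⟩ := R.exists_isWaterFilling hM (t := m + 1) (by omega) ω
          exact hc.lossLOT_le fun i =>
            R.demand_le_usedDemand hM (Set.mem_univ i) (h i) hm.1
      _ = ∑ i, ∑ m ∈ Finset.Ico 1 T, max (R.alloc (m + 1) i ω - M.demand (m + 1) i) 0 :=
          Finset.sum_comm
      _ ≤ _ := by
          refine (Finset.sum_le_card_nsmul _ _ _ fun i _ =>
            R.sum_alloc_sub_demand_le hM hδ₀ (Set.mem_univ i) (h i) T).trans (le_of_eq ?_)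
          rw [Finset.card_univ, Fintype.card_fin, nsmul_eq_mul]
  have hle : R.loss T ω ≤ 1 + ∑ m ∈ Finset.Ico 1 T,
      lossLOT (M.demand (m + 1)) (fun i => R.alloc (m + 1) i ω) := by
    rw [loss, sum_Icc_one_eq_sum_range]
    rcases Nat.eq_zero_or_pos T with rfl | hT
    · simp
    · rw [Finset.range_eq_Ico, Finset.sum_eq_sum_Ico_succ_bot hT]
      exact add_le_add hone le_rfl
  rw [lossBound]
  linarith

/-- Since the water level is at least `1`, agent `i` gets at least `min (D i) (e i)`, with `D i` her
used demand, whatever the others ask for. Only her own confidence bound matters. -/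
theorem entitlUtility_le (R : Run M δ H P) (hM : M.Valid) {i : Fin n} (hi : i ∈ H) {ω : Ω}
    (h : R.IsConfident i ω) (T : ℕ) : M.entitlUtility i T ≤ R.utility i T ω := by
  rw [Model.entitlUtility, utility, sum_Icc_one_eq_sum_range, sum_Icc_one_eq_sum_range]
  refine Finset.sum_le_sum fun m _ => ?_
  have hv := hM.load_pos m i
  have he := hM.entitl_pos i
  rcases Nat.eq_zero_or_pos m with rfl | hm
  · simp [R.alloc_one]
  · rw [← hM.util_min_demand]
    refine hM.util_mono i (div_nonneg (le_min he.le (hM.demand_nonneg m i)) hv.le)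
      (div_le_div_of_nonneg_right ?_ hv.le)
    obtain ⟨c, hc⟩ := R.exists_isWaterFilling hM (t := m + 1) (by omega) ω
    refine le_trans ?_ (hc.min_entitl_le hM.entitl_pos i)
    rw [min_comm]
    exact min_le_min_right _ (R.demand_le_usedDemand hM hi h hm)

/-- The gain of agent `i` on a round is controlled by the over-allocation to the others in the run
in which all are truthful. -/
theorem util_sub_util_le (hM : M.Valid) (R : Run M δ Set.univ P) {i : Fin n}
    (S : Run M δ {i}ᶜ P) {ω : Ω} (hR : R.IsConfident i ω)
    (hS : ∀ j, j ≠ i → S.IsConfident j ω) {m : ℕ} (hm : 1 ≤ m) :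
    M.util i (S.alloc (m + 1) i ω / M.load (m + 1) i)
        - M.util i (R.alloc (m + 1) i ω / M.load (m + 1) i)
      ≤ M.lip i / M.loadMin * ∑ j ∈ Finset.univ.erase i,
        max (R.alloc (m + 1) j ω - M.demand (m + 1) j) 0 := by
  have hv := hM.load_pos m i
  have hd := hM.demand_nonneg m i
  have he := hM.entitl_pos
  -- The histories of the two runs may differ entirely, so each is compared with the water filling
  -- for the true demands.
  obtain ⟨c, hc⟩ := exists_isWaterFilling_mmf (d := M.demand (m + 1)) he hM.entitl_sum
  obtain ⟨cR, hcR⟩ := R.exists_isWaterFilling hM (t := m + 1) (by omega) ω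
  obtain ⟨cS, hcS⟩ := S.exists_isWaterFilling hM (t := m + 1) (by omega) ω
  set b := mmf M.entitl (M.demand (m + 1)) i
  have hb0 : 0 ≤ b := hc.nonneg he (hM.demand_nonneg m) i
  have h1 : min (S.alloc (m + 1) i ω) (M.demand (m + 1) i) ≤ b :=
    hc.min_le_of_le hcS he i fun j hj => S.demand_le_usedDemand hM hj (hS j hj) hm
  have h2 : b - min (R.alloc (m + 1) i ω) (M.demand (m + 1) i) ≤ ∑ j ∈ Finset.univ.erase i,
      max (R.alloc (m + 1) j ω - M.demand (m + 1) j) 0 :=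
    hc.sub_min_le hcR he i (R.demand_le_usedDemand hM (Set.mem_univ i) hR hm)
  set r := min (R.alloc (m + 1) i ω) (M.demand (m + 1) i) with hr
  have hr0 : 0 ≤ r := le_min (R.alloc_nonneg hM m i ω) hd
  set O := ∑ j ∈ Finset.univ.erase i, max (R.alloc (m + 1) j ω - M.demand (m + 1) j) 0
  have hO : 0 ≤ O := Finset.sum_nonneg fun j _ => le_max_right _ _
  have h3 : M.util i (S.alloc (m + 1) i ω / M.load (m + 1) i)
      ≤ M.util i (b / M.load (m + 1) i) := by
    rw [← hM.util_min_demand]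
    exact hM.util_mono i (div_nonneg (le_min (S.alloc_nonneg hM m i ω) hd) hv.le)
      (div_le_div_of_nonneg_right h1 hv.le)
  rw [← hM.util_min_demand i m (R.alloc (m + 1) i ω), ← hr]
  have hL : (0 : ℝ) ≤ M.lip i := (M.lip i).2
  rcases le_total b r with hbr | hbr
  · have := hM.util_mono i (div_nonneg hb0 hv.le) (div_le_div_of_nonneg_right hbr hv.le)
    have : 0 ≤ M.lip i / M.loadMin * O := mul_nonneg (div_nonneg hL hM.loadMin_pos.le) hO
    linarith
  · have h4 := (hM.util_lip i).dist_le_mul (b / M.load (m + 1) i)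
      (div_nonneg hb0 hv.le) (r / M.load (m + 1) i) (div_nonneg hr0 hv.le)
    rw [Real.dist_eq, Real.dist_eq, ← sub_div,
      abs_of_nonneg (div_nonneg (sub_nonneg.2 hbr) hv.le)] at h4
    have h5 : M.lip i * ((b - r) / M.load (m + 1) i) ≤ M.lip i / M.loadMin * O := by
      rw [div_mul_eq_mul_div, mul_div_assoc]
      refine mul_le_mul_of_nonneg_left ?_ hL
      exact div_le_div₀ hO h2 hM.loadMin_pos (hM.load_mem (m + 1) i (by omega)).1.le
    linarith [le_abs_self (M.util i (b / M.load (m + 1) i) - M.util i (r / M.load (m + 1) i))]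

theorem utility_sub_utility_le_gainBound (hM : M.Valid) (hδ₀ : 0 < δ) (R : Run M δ Set.univ P)
    {i : Fin n} (S : Run M δ {i}ᶜ P) {ω : Ω} (hR : ∀ j, R.IsConfident j ω)
    (hS : ∀ j, j ≠ i → S.IsConfident j ω) (T : ℕ) :
    S.utility i T ω - R.utility i T ω
      ≤ gainBound (M.lip i) M.loadMin M.kappa M.C₂ M.C₃ n δ T := by
  have hcoef : (0 : ℝ) ≤ M.lip i / M.loadMin := div_nonneg (M.lip i).2 hM.loadMin_pos.le
  set f : ℕ → ℝ := fun t => M.util i (S.alloc t i ω / M.load t i)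
        - M.util i (R.alloc t i ω / M.load t i) with hf
  -- On round `1` the allocation ignores the reports, so nothing is gained there.
  have hdiff : S.utility i T ω - R.utility i T ω = ∑ m ∈ Finset.Ico 1 T, f (m + 1) := by
    rw [utility, utility, ← Finset.sum_sub_distrib, sum_Icc_one_eq_sum_range f]
    rcases Nat.eq_zero_or_pos T with rfl | hT
    · simp
    · rw [Finset.range_eq_Ico, Finset.sum_eq_sum_Ico_succ_bot hT]
      simp [hf, R.alloc_one, S.alloc_one]
  rw [hdiff]
  calc _ ≤ ∑ m ∈ Finset.Ico 1 T, M.lip i / M.loadMin * ∑ j ∈ Finset.univ.erase i,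
        max (R.alloc (m + 1) j ω - M.demand (m + 1) j) 0 :=
        Finset.sum_le_sum fun m hm =>
          util_sub_util_le hM R S (hR i) hS (Finset.mem_Ico.1 hm).1
    _ = M.lip i / M.loadMin * ∑ j ∈ Finset.univ.erase i, ∑ m ∈ Finset.Ico 1 T,
        max (R.alloc (m + 1) j ω - M.demand (m + 1) j) 0 := by
        rw [← Finset.mul_sum, Finset.sum_comm]
    _ ≤ M.lip i / M.loadMin * (((n : ℝ) - 1) *
        (M.C₂ * max 1 (betaWidth M.kappa n δ (T - 1)) * √T * √(Real.log (M.C₃ * T)))) := by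
        refine mul_le_mul_of_nonneg_left ?_ hcoef
        refine (Finset.sum_le_card_nsmul _ _ _ fun j _ =>
            R.sum_alloc_sub_demand_le hM hδ₀ (Set.mem_univ j) (hR j) T).trans (le_of_eq ?_)
        rw [Finset.card_erase_of_mem (Finset.mem_univ i), Finset.card_univ, Fintype.card_fin,
          nsmul_eq_mul, Nat.cast_sub hM.one_le, Nat.cast_one]
    _ = _ := by rw [gainBound]; ring

end Run

/-! ### The rates of the bounds -/

theorem half_le_log {x : ℝ} (hx : 2 ≤ x) : 1 / 2 ≤ Real.log x := by
  have h1 := Real.log_two_gt_d9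
  have h2 := Real.log_le_log (by norm_num) hx
  linarith

/-- For `T ≥ 2` both logarithms in the rate are at least `1 / 2`, so additive constants can be
absorbed: the `1` in the maximum and `log (c₃ + 1)`. The second conjunct absorbs the `1` in
`lossBound`. -/
theorem exists_bound_le_rate {κ c₃ : ℝ} (hκ : 0 < κ) (hc₃ : 0 < c₃) :
    ∃ K : ℝ, 0 ≤ K ∧ ∀ (m : ℕ) (η : ℝ) (T : ℕ), 1 ≤ m → 0 < η → η < 1 → 2 ≤ T →
      m * (max 1 (betaWidth κ m η (T - 1)) * √T * √(Real.log (c₃ * T))) ≤ K * rate m η T ∧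
      1 ≤ 2 * rate m η T := by
  set B := 2 + 10 / κ with hB
  set C := 2 * Real.log (c₃ + 1) + 1 with hC
  have hlogc : 0 ≤ Real.log (c₃ + 1) := Real.log_nonneg (by linarith)
  refine ⟨B * √C, by positivity, fun m η T hm hη₀ hη₁ hT => ?_⟩
  have hm' : (1 : ℝ) ≤ m := by exact_mod_cast hm
  have hT' : (2 : ℝ) ≤ T := by exact_mod_cast hT
  have hTq : (T : ℝ) ≤ m * T / η := by
    rw [le_div_iff₀ hη₀]; nlinarith
  set q := m * T / η with hq
  have hΛ : 1 / 2 ≤ Real.log q := half_le_log (hT'.trans hTq)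
  have hlam : 1 / 2 ≤ Real.log T := half_le_log hT'
  have hsqrtΛ : 1 / 2 ≤ √(Real.log q) := Real.le_sqrt_of_sq_le (by norm_num; linarith)
  have hbeta : betaWidth κ m η (T - 1) ≤ 10 / κ * √(Real.log q) := by
    have hT1 : (1 : ℝ) ≤ ((T - 1 : ℕ) : ℝ) := by exact_mod_cast (by omega : 1 ≤ T - 1)
    have hT2 : ((T - 1 : ℕ) : ℝ) ≤ T := by exact_mod_cast Nat.sub_le T 1
    have hpi : Real.pi ^ 2 ≤ 12 := by nlinarith [Real.pi_lt_d2, Real.pi_pos]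
    -- A fourth power suffices, since it only multiplies the logarithm by `4`.
    have harg : m * Real.pi ^ 2 * ((T - 1 : ℕ) : ℝ) ^ 2 / (6 * η) ≤ q ^ 4 := by
      calc _ ≤ m * 12 * (T : ℝ) ^ 2 / (6 * η) := by gcongr
        _ = 2 * T * q := by rw [hq]; field_simp; ring
        _ ≤ q * q * q := by
            have : 0 < q := by linarith
            gcongr
            linarith
        _ ≤ q ^ 4 := by
            have : 1 ≤ q := by linarith
            nlinarith [pow_pos (by linarith : 0 < q) 3]
    have hlog : Real.log (m * Real.pi ^ 2 * ((T - 1 : ℕ) : ℝ) ^ 2 / (6 * η))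
        ≤ 4 * Real.log q := by
      refine (Real.log_le_log (by positivity) harg).trans (le_of_eq ?_)
      rw [Real.log_pow]; norm_num
    have hsqrt : √(4 * Real.log q) = 2 * √(Real.log q) := by
      rw [Real.sqrt_mul (by norm_num), show (4 : ℝ) = 2 ^ 2 by norm_num,
        Real.sqrt_sq (by norm_num)]
    calc _ ≤ 5 / κ * √(4 * Real.log q) :=
          mul_le_mul_of_nonneg_left (Real.sqrt_le_sqrt hlog) (by positivity)
      _ = _ := by rw [hsqrt]; ring
  have hmax : max 1 (betaWidth κ m η (T - 1)) ≤ B * √(Real.log q) := by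
    have : 0 ≤ 10 / κ * √(Real.log q) := by positivity
    refine max_le ?_ ?_ <;> rw [hB, add_mul] <;> linarith
  have hlogc3 : √(Real.log (c₃ * T)) ≤ √C * √(Real.log T) := by
    rw [← Real.sqrt_mul (by positivity)]
    refine Real.sqrt_le_sqrt ?_
    calc _ ≤ Real.log ((c₃ + 1) * T) :=
          Real.log_le_log (by positivity) (by gcongr; linarith)
      _ = Real.log (c₃ + 1) + Real.log T := Real.log_mul (by positivity) (by positivity)
      _ ≤ _ := by rw [hC]; nlinarith
  constructor
  · calc _ ≤ m * (B * √(Real.log q) * √T * (√C * √(Real.log T))) := by gcongr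
      _ = _ := by rw [rate, ← hq, Real.sqrt_mul (by linarith)]; ring
  · have h1 : 1 ≤ √(T : ℝ) := Real.one_le_sqrt.2 (by linarith)
    have h2 : 1 / 2 ≤ √(Real.log q * Real.log T) :=
      Real.le_sqrt_of_sq_le (by nlinarith)
    have h3 : 1 ≤ m * √(T : ℝ) := one_le_mul_of_one_le_of_one_le hm' h1
    have h4 : 1 * (1 / 2) ≤ m * √(T : ℝ) * √(Real.log q * Real.log T) :=
      mul_le_mul h3 h2 (by norm_num) (by positivity)
    rw [rate, ← hq]
    linarith

theorem exists_lossBound_le_rate {κ c₂ c₃ : ℝ} (hκ : 0 < κ) (hc₂ : 0 ≤ c₂) (hc₃ : 0 < c₃) :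
    ∃ K : ℝ, ∀ (m : ℕ) (η : ℝ) (T : ℕ), 1 ≤ m → 0 < η → η < 1 → 2 ≤ T →
      lossBound κ c₂ c₃ m η T ≤ K * rate m η T := by
  obtain ⟨K, -, hK⟩ := exists_bound_le_rate hκ hc₃
  refine ⟨2 + c₂ * K, fun m η T hm hη₀ hη₁ hT => ?_⟩
  obtain ⟨h1, h2⟩ := hK m η T hm hη₀ hη₁ hT
  have h3 := mul_le_mul_of_nonneg_left h1 hc₂
  rw [lossBound]
  linarith

theorem exists_gainBound_le_rate {L v κ c₂ c₃ : ℝ} (hL : 0 ≤ L) (hv : 0 < v) (hκ : 0 < κ)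
    (hc₂ : 0 ≤ c₂) (hc₃ : 0 < c₃) :
    ∃ K : ℝ, ∀ (m : ℕ) (η : ℝ) (T : ℕ), 1 ≤ m → 0 < η → η < 1 → 2 ≤ T →
      gainBound L v κ c₂ c₃ m η T ≤ K * rate m η T := by
  obtain ⟨K, -, hK⟩ := exists_bound_le_rate hκ hc₃
  refine ⟨L * c₂ / v * K, fun m η T hm hη₀ hη₁ hT => ?_⟩
  obtain ⟨h1, -⟩ := hK m η T hm hη₀ hη₁ hT
  have hcoef : 0 ≤ L * c₂ / v := by positivity
  have h3 := mul_le_mul_of_nonneg_left h1 hcoef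
  have hX : 0 ≤ L * c₂ / v * (max 1 (betaWidth κ m η (T - 1)) * √T * √(Real.log (c₃ * T))) := by
    have : 0 ≤ max 1 (betaWidth κ m η (T - 1)) := zero_le_one.trans (le_max_left _ _)
    positivity
  rw [gainBound]
  linarith

/-- The geometric mean of the two logarithms is at most `log (n / δ) + log T`, which is `o(√T)`. -/
theorem rate_isLittleO {n : ℕ} {δ : ℝ} (hn : 1 ≤ n) (hδ₀ : 0 < δ) (hδ₁ : δ < 1) :
    (fun T : ℕ => rate n δ T) =o[atTop] (fun T : ℕ => (T : ℝ)) := by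
  have hn' : (1 : ℝ) ≤ n := by exact_mod_cast hn
  have hcast : Tendsto (fun T : ℕ => (T : ℝ)) atTop atTop := tendsto_natCast_atTop_atTop
  have hlog : (fun T : ℕ => Real.log (n / δ) + Real.log T) =o[atTop]
      (fun T : ℕ => √(T : ℝ)) := by
    refine IsLittleO.add ?_ ?_
    · refine isLittleO_const_left.2 (Or.inr ?_)
      exact tendsto_norm_atTop_atTop.comp (Real.tendsto_sqrt_atTop.comp hcast)
    · have := (isLittleO_log_rpow_atTop (r := 1 / 2) (by norm_num)).comp_tendsto hcast
      simpa only [Function.comp_def, ← Real.sqrt_eq_rpow] using this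
  have hprod : (fun T : ℕ => √(T : ℝ) * (Real.log (n / δ) + Real.log T)) =o[atTop]
      (fun T : ℕ => (T : ℝ)) := by
    have := (isBigO_refl (fun T : ℕ => √(T : ℝ)) atTop).mul_isLittleO hlog
    simpa only [Real.mul_self_sqrt (Nat.cast_nonneg _)] using this
  refine IsBigO.trans_isLittleO (IsBigO.of_bound n ?_) hprod
  filter_upwards [eventually_ge_atTop 2] with T hT
  have hT' : (2 : ℝ) ≤ T := by exact_mod_cast hT
  have hc : 0 ≤ Real.log (n / δ) := Real.log_nonneg ((one_le_div hδ₀).2 (by linarith))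
  have hl : 0 ≤ Real.log T := Real.log_nonneg (by linarith)
  have heq : Real.log (n * T / δ) = Real.log (n / δ) + Real.log T := by
    rw [← Real.log_mul (by positivity) (by positivity)]; congr 1; ring
  rw [Real.norm_of_nonneg (by rw [rate]; positivity), Real.norm_of_nonneg (by positivity), rate,
    heq, mul_assoc]
  gcongr
  refine Real.sqrt_le_iff.2 ⟨by positivity, ?_⟩
  nlinarith

theorem isLittleO_of_le_rate {n : ℕ} {δ : ℝ} (hn : 1 ≤ n) (hδ₀ : 0 < δ) (hδ₁ : δ < 1)
    {f : ℕ → ℝ} (hf : ∀ T, 0 ≤ f T) {K : ℝ} (hK : ∀ T, 2 ≤ T → f T ≤ K * rate n δ T) :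
    f =o[atTop] (fun T : ℕ => (T : ℝ)) := by
  refine IsBigO.trans_isLittleO (IsBigO.of_bound |K| ?_) (rate_isLittleO hn hδ₀ hδ₁)
  filter_upwards [eventually_ge_atTop 2] with T hT
  rw [Real.norm_of_nonneg (hf T), Real.norm_eq_abs, ← abs_mul]
  exact (hK T hT).trans (le_abs_self _)

theorem gainBound_nonneg {L v κ c₂ c₃ : ℝ} (hL : 0 ≤ L) (hv : 0 < v) (hc₂ : 0 ≤ c₂) {n : ℕ}
    (hn : 1 ≤ n) (δ : ℝ) (T : ℕ) : 0 ≤ gainBound L v κ c₂ c₃ n δ T := by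
  have h1 : (0 : ℝ) ≤ (n : ℝ) - 1 := sub_nonneg.2 (by exact_mod_cast hn)
  have h2 : 0 ≤ max 1 (betaWidth κ n δ (T - 1)) := zero_le_one.trans (le_max_left _ _)
  rw [gainBound]
  positivity

theorem Model.Valid.C₃_pos {n : ℕ} {M : Model n} (hM : M.Valid) : 0 < M.C₃ := by
  have := hM.loadMin_pos
  have := hM.sgcMin_pos
  have := hM.loadMax_pos
  have := hM.sgcMax_pos
  have := hM.iInf_entitl_pos
  rw [Model.C₃]
  positivity

/-- The complement of a set of small outer measure contains a measurable set of large measure. -/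
theorem exists_measurableSet_of_measure_lt {Ω : Type*} [MeasurableSpace Ω] {P : Measure Ω}
    [IsProbabilityMeasure P] {B : Set Ω} {δ : ℝ} (hδ₁ : δ < 1) (hB : P B < ENNReal.ofReal δ) :
    ∃ G : Set Ω, MeasurableSet G ∧ ENNReal.ofReal (1 - δ) < P G ∧ ∀ ω ∈ G, ω ∉ B := by
  refine ⟨(toMeasurable P B)ᶜ, (measurableSet_toMeasurable P B).compl, ?_,
    fun ω hω hωB => hω (subset_toMeasurable P B hωB)⟩
  rw [prob_compl_eq_one_sub (measurableSet_toMeasurable P B), measure_toMeasurable]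
  have hδ₀ : 0 < δ := ENNReal.ofReal_pos.1 (zero_le.trans_lt hB)
  refine lt_tsub_iff_right.2 ((ENNReal.add_lt_add_left ENNReal.ofReal_ne_top hB).trans_eq ?_)
  rw [← ENNReal.ofReal_add (sub_nonneg.2 hδ₁.le) hδ₀.le, sub_add_cancel, ENNReal.ofReal_one]

end FairDivision

end


theorem theorem6 {n : ℕ} (M : FairDivision.Model n) (hM : M.Valid)
    (δ : ℝ) (hδ₀ : 0 < δ) (hδ₁ : δ < 1)
    {Ω : Type*} [MeasurableSpace Ω] (P : Measure Ω) [IsProbabilityMeasure P] :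
    -- all agents are truthful in the run R; in the run S all agents except possibly i are truthful
    (∀ (R : FairDivision.Run M δ Set.univ P) (i : Fin n) (S : FairDivision.Run M δ {i}ᶜ P),
      ∃ G : Set Ω, MeasurableSet G ∧ ENNReal.ofReal (1 - δ) < P G ∧ ∀ ω ∈ G,
        -- efficiency
        (∀ T : ℕ, R.loss T ω ≤ FairDivision.lossBound M.kappa M.C₂ M.C₃ n δ T) ∧
        (fun T : ℕ => R.loss T ω) =o[atTop] (fun T : ℕ => (T : ℝ)) ∧
        -- fairness
        (∀ (j : Fin n) (T : ℕ), M.entitlUtility j T ≤ R.utility j T ω) ∧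
        -- Bayes-Nash incentive-compatibility
        (∀ T : ℕ, S.utility i T ω - R.utility i T ω ≤
          FairDivision.gainBound (M.lip i) M.loadMin M.kappa M.C₂ M.C₃ n δ T) ∧
        (fun T : ℕ => max (S.utility i T ω - R.utility i T ω) 0) =o[atTop]
          (fun T : ℕ => (T : ℝ))) ∧
    -- fairness to a truthful agent does not need the other agents to be truthful
    (∀ (i : Fin n) (R : FairDivision.Run M δ {i} P),
      ∃ G : Set Ω, MeasurableSet G ∧ ENNReal.ofReal (1 - δ) < P G ∧
        ∀ ω ∈ G, ∀ T : ℕ, M.entitlUtility i T ≤ R.utility i T ω) ∧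
    -- the rates of the two bounds, for fixed values of the other constants
    (∃ K : ℝ, ∀ (m : ℕ) (η : ℝ) (T : ℕ), 1 ≤ m → 0 < η → η < 1 → 2 ≤ T →
      FairDivision.lossBound M.kappa M.C₂ M.C₃ m η T ≤ K * FairDivision.rate m η T) ∧
    (∀ i : Fin n, ∃ K : ℝ, ∀ (m : ℕ) (η : ℝ) (T : ℕ), 1 ≤ m → 0 < η → η < 1 → 2 ≤ T →
      FairDivision.gainBound (M.lip i) M.loadMin M.kappa M.C₂ M.C₃ m η T ≤
        K * FairDivision.rate m η T) := by
  have hn := hM.one_le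
  have hκ := hM.kappa_pos
  have hC₂ := M.C₂_nonneg
  have hC₃ := hM.C₃_pos
  have hrateLoss := FairDivision.exists_lossBound_le_rate hκ hC₂ hC₃
  have hrateGain : ∀ i, _ := fun i =>
    FairDivision.exists_gainBound_le_rate (M.lip i).2 hM.loadMin_pos hκ hC₂ hC₃
  refine ⟨fun R i S => ?_, fun i R => ?_, hrateLoss, hrateGain⟩
  · obtain ⟨G, hG, hPG, hGB⟩ := FairDivision.exists_measurableSet_of_measure_lt (P := P)
      -- A union bound over the two runs needs nothing about their joint law; `0.46 * δ + 0.46 * δ <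
      -- δ` gives the strict inequality.
      (B := {ω | ∃ i, ¬ R.IsConfident i ω} ∪ {ω | ∃ i, ¬ S.IsConfident i ω}) hδ₁ (by
        refine (measure_union_le _ _).trans_lt ((add_le_add
          (R.measure_exists_not_isConfident_le hM hδ₀ hδ₁)
          (S.measure_exists_not_isConfident_le hM hδ₀ hδ₁)).trans_lt ?_)
        rw [← ENNReal.ofReal_add (by positivity) (by positivity)]
        exact (ENNReal.ofReal_lt_ofReal_iff hδ₀).2 (by linarith))
    refine ⟨G, hG, hPG, fun ω hω => ?_⟩
    have hnot := hGB ω hω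
    have hR : ∀ j, R.IsConfident j ω := fun j => by
      by_contra h; exact hnot (Or.inl ⟨j, h⟩)
    have hS : ∀ j, S.IsConfident j ω := fun j => by
      by_contra h; exact hnot (Or.inr ⟨j, h⟩)
    have hloss := R.loss_le_lossBound hM hδ₀ hR
    have hgain := FairDivision.Run.utility_sub_utility_le_gainBound hM hδ₀ R S hR fun j _ => hS j
    obtain ⟨K, hK⟩ := hrateLoss
    obtain ⟨K', hK'⟩ := hrateGain i
    refine ⟨hloss, ?_, fun j T => R.entitlUtility_le hM (Set.mem_univ j) (hR j) T, hgain, ?_⟩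
    · exact FairDivision.isLittleO_of_le_rate hn hδ₀ hδ₁ (fun T => R.loss_nonneg hM T ω)
        fun T hT => (hloss T).trans (hK n δ T hn hδ₀ hδ₁ hT)
    · refine FairDivision.isLittleO_of_le_rate hn hδ₀ hδ₁ (fun T => le_max_right _ _)
        fun T hT => le_trans (max_le (hgain T) ?_) (hK' n δ T hn hδ₀ hδ₁ hT)
      exact FairDivision.gainBound_nonneg (M.lip i).2 hM.loadMin_pos hC₂ hn δ T
  · obtain ⟨G, hG, hPG, hGB⟩ := FairDivision.exists_measurableSet_of_measure_lt (P := P)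
      (B := {ω | ∃ i, ¬ R.IsConfident i ω}) hδ₁
      ((R.measure_exists_not_isConfident_le hM hδ₀ hδ₁).trans_lt
        ((ENNReal.ofReal_lt_ofReal_iff hδ₀).2 (by linarith)))
    refine ⟨G, hG, hPG, fun ω hω => R.entitlUtility_le hM rfl ?_⟩
    by_contra h
    exact hGB ω hω ⟨i, h⟩
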